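/- Let $V$ be a finite set and let $G$ be the complete graph on $V$, with edge set $E$, equipped with edge weights $c_{xy}=c_{yx}\ge 0$ for $xy\in E$, such that the graph formed by the edges of positive weight is connected. For the generator $\mathcal L$ of an irreducible continuous-time Markov chain on a finite state space with symmetric transition rates, let $0=\lambda_0<\lambda_1\le\lambda_2\le\cdots$ be the eigenvalues of $-\mathcal L$, listed with multiplicity; $\lambda_1$ is called the spectral gap of the chain. The random walk on $G$ is the Markov chain on $V$ with generator $$\mathcal L^{RW}f(x)=\sum_{y\ne x}c_{xy}\,(f(y)-f(x)),\qquad f:V\to\mathbb R,$$ and $\lambda_1^{RW}(G)$ denotes its spectral gap. Let $r\ge 2$ and $n_1,\dots,n_r\ge 1$ be integers with $n_1+\cdots+n_r=|V|$. The colored exclusion process on $G$ is the Markov chain whose states are the ordered partitions $\alpha=(\alpha_1,\dots,\alpha_r)$ of $V$ with $|\alpha_i|=n_i$ for all $i$ ($\alpha_i$ being the set of vertices occupied by particles of color $i$), with generator $$\mathcal L^{CEP}f(\alpha)=\sum_{xy\in E}c_{xy}\,(f(\alpha^{xy})-f(\alpha)),$$ where $\alpha^{xy}$ is obtained from $\alpha$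 by interchanging the particles at $x$ and $y$, that is, by replacing each $\alpha_i$ by its image under the transposition of $x$ and $y$. Let $\lambda_1^{CEP}(G)$ denote its spectral gap. Then, for all such $G$, $r$ and $n_1,\dots,n_r$, $$\lambda_1^{CEP}(G)=\lambda_1^{RW}(G).$$ -/

import Mathlib

/-- An undirected weighted complete graph on the vertex set `V`: every edge `{x, y}`, `x ≠ y`,
carries a conductance `c {x, y} ≥ 0`. (Values of `c` on the diagonal of `Sym2 V` are never used.) -/
structure WeightedGraph (V : Type*) where
  /-- the conductance of an edge -/
  c : Sym2 V → ℝ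
  c_nonneg : ∀ x y : V, x ≠ y → 0 ≤ c s(x, y)

/-- The skeleton graph: its edges are the pairs `{x, y}`, `x ≠ y`, of positive weight. -/
def WeightedGraph.skeleton {V : Type*} (G : WeightedGraph V) : SimpleGraph V where
  Adj x y := x ≠ y ∧ 0 < G.c s(x, y)
  symm := ⟨fun x y h => ⟨h.1.symm, by rw [Sym2.eq_swap]; exact h.2⟩⟩
  loopless := ⟨fun _ h => h.1 rfl⟩

/-- The spectral gap `λ₁` of a Markov chain with finite state space `S` and generator `L`:
if `λ₀ ≤ λ₁ ≤ ⋯` are the eigenvalues of `-L`, listed in increasing order with multiplicity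
(as roots of the characteristic polynomial), it is the entry with index `1`. The default value
`0` is used only if `-L` has fewer than two real eigenvalues. -/
noncomputable def spectralGap {S : Type*} [Finite S] (L : (S → ℝ) →ₗ[ℝ] (S → ℝ)) : ℝ :=
  ((-L).charpoly.roots.sort (· ≤ ·)).getD 1 0

/-- The generator of the random walk on `G`:
`L f (x) = ∑_{y ≠ x} c_{xy} (f y - f x)`. -/
noncomputable def WeightedGraph.randomWalkGenerator {V : Type*} [Fintype V] [DecidableEq V]
    (G : WeightedGraph V) : (V → ℝ) →ₗ[ℝ] (V → ℝ) where
  toFun f x := ∑ y ∈ Finset.univ.erase x, G.c s(x, y) * (f y - f x)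
  map_add' f g := by
    funext x
    simp only [Pi.add_apply, ← Finset.sum_add_distrib]
    exact Finset.sum_congr rfl fun y _ => by ring
  map_smul' a f := by
    funext x
    simp only [Pi.smul_apply, smul_eq_mul, RingHom.id_apply, Finset.mul_sum]
    exact Finset.sum_congr rfl fun y _ => by ring

/-- The state space of the colored exclusion process with `n i` particles of color `i`: the
ordered partitions `α = (α_i)_{i < r}` of `V` with `|α_i| = n i`, where `α_i` is the set of
vertices occupied by particles of color `i`. -/
abbrev ColoredConfig (V : Type*) [Fintype V] [DecidableEq V] {r : ℕ} (n : Fin r → ℕ) : Type _ :=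
  {α : Fin r → Finset V //
    (∀ i j, i ≠ j → Disjoint (α i) (α j)) ∧ (∀ x, ∃ i, x ∈ α i) ∧ ∀ i, (α i).card = n i}

/-- The transposition of the two end points of a pair `{x, y}`. -/
def pairSwap {V : Type*} [DecidableEq V] (e : Sym2 V) : Equiv.Perm V :=
  Sym2.lift ⟨fun x y => Equiv.swap x y, fun x y => Equiv.swap_comm x y⟩ e

/-- The state `α^{xy}`, in which the particles at `x` and `y` have interchanged their positions:
each block `α_i` is replaced by its image under the transposition of `x` and `y`. -/
def ColoredConfig.exchange {V : Type*} [Fintype V] [DecidableEq V] {r : ℕ} {n : Fin r → ℕ}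
    (e : Sym2 V) (α : ColoredConfig V n) : ColoredConfig V n :=
  ⟨fun i => (α.1 i).map (pairSwap e).toEmbedding,
    fun i j hij => (Finset.disjoint_map _).2 (α.2.1 i j hij),
    fun x => by
      obtain ⟨i, hi⟩ := α.2.2.1 ((pairSwap e).symm x)
      exact ⟨i, Finset.mem_map.2 ⟨_, hi, (pairSwap e).apply_symm_apply x⟩⟩,
    fun i => (Finset.card_map _).trans (α.2.2.2 i)⟩

/-- The generator of the colored exclusion process on `G`:
`L f (α) = ∑_{xy ∈ E} c_{xy} (f (α^{xy}) - f α)`, where `E` is the edge set of the complete graph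
on `V`. -/
noncomputable def WeightedGraph.coloredExclusionGenerator {V : Type*} [Fintype V] [DecidableEq V]
    (G : WeightedGraph V) {r : ℕ} (n : Fin r → ℕ) :
    (ColoredConfig V n → ℝ) →ₗ[ℝ] (ColoredConfig V n → ℝ) where
  toFun f α := ∑ e ∈ (⊤ : SimpleGraph V).edgeFinset, G.c e * (f (α.exchange e) - f α)
  map_add' f g := by
    funext α
    simp only [Pi.add_apply, ← Finset.sum_add_distrib]
    exact Finset.sum_congr rfl fun e _ => by ring
  map_smul' a f := by
    funext α
    simp only [Pi.smul_apply, smul_eq_mul, RingHom.id_apply, Finset.mul_sum]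
    exact Finset.sum_congr rfl fun e _ => by ring

open Equiv

/-! This is Aldous' spectral gap theorem (Caputo, Liggett, Richthammer), passed from the interchange
process on `Perm V` to its colored quotient. Upper bound: summing a gap eigenfunction of the walk
over the vertices of one color gives an exclusion eigenfunction with the same eigenvalue. Lower
bound: exclusion eigenfunctions pull back to the interchange process, so it suffices that the latter
inherits the Poincaré inequality of the walk (`interchangePoincare_of_walkPoincare`).

That is an induction on the number of vertices. Fix a vertex `none` and an interchange
eigenfunction. If, for some particle, its sum over the configurations with that particle at `none`
is nonzero, it projects to a walk eigenfunction with the same eigenvalue. Otherwise it has zero sum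
on each such fibre, where the induction hypothesis applies to the network with `none` eliminated.
Elimination preserves the Poincaré constant of the walk, by harmonic extension
(`WalkPoincare.reduced`), and does not increase the interchange energy, by `octopus_inequality`.

The octopus inequality says `a + T ≥ 0`, with `a` the total rate and `T` the off-diagonal part. It
follows from `‖T f‖ ≤ a ‖f‖`: the difference of the squares is a quartic polynomial in the
conductances with nonnegative symmetrized coefficients `octopusForm`. These are linear in the
positive definite function `corr f`; with four or three distinct legs they are a quarter of its
pairing with a multiple of an idempotent of `S₅` or `S₄`, and with fewer legs they vanish. -/

/-- The autocorrelation of a function on a finite group. -/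
def corr {G : Type*} [Group G] [Fintype G] (f : G → ℝ) (g : G) : ℝ := ∑ a, f a * f (a * g)

/-! ### Positivity of autocorrelations on a finite group -/

section Correlation

variable {G H : Type*} [Group G] [Fintype G] [Group H] [Fintype H]

theorem sum_translate_mul_translate (f : G → ℝ) (g h : G) :
    ∑ a, f (a * g) * f (a * h) = corr f (g⁻¹ * h) := by
  unfold corr
  symm
  rw [← Equiv.sum_comp (Equiv.mulRight g)]
  simp [mul_assoc]

theorem corr_inv (f : G → ℝ) (g : G) : corr f g⁻¹ = corr f g := by
  have h := sum_translate_mul_translate f g 1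
  rw [mul_one] at h
  rw [← h, corr]
  simp [mul_comm]

theorem corr_one (f : G → ℝ) : corr f 1 = ∑ a, f a ^ 2 := by
  simp [corr, sq]

/-- Positivity of the autocorrelation, tested on an element `Z * star Z` of the group algebra of a
group `H` mapping to `G`. -/
theorem sum_convolution_mul_corr_nonneg (φ : H →* G) (Z : H → ℝ) (f : G → ℝ) :
    0 ≤ ∑ g, (∑ h, Z (g * h) * Z h) * corr f (φ g) := by
  -- The pairing is the squared norm of `f` convolved with `Z`.
  have key : ∑ a, (∑ h, Z h * f (a * (φ h)⁻¹)) ^ 2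
      = ∑ g, (∑ h, Z (g * h) * Z h) * corr f (φ g) := by
    calc ∑ a, (∑ h, Z h * f (a * (φ h)⁻¹)) ^ 2
        = ∑ a, ∑ h, ∑ h', Z h * Z h' * (f (a * (φ h')⁻¹) * f (a * (φ h)⁻¹)) := by
          refine Finset.sum_congr rfl fun a _ => ?_
          rw [sq, Finset.sum_mul_sum]
          exact Finset.sum_congr rfl fun h _ => Finset.sum_congr rfl fun h' _ => by ring
      _ = ∑ h, ∑ h', ∑ a, Z h * Z h' * (f (a * (φ h')⁻¹) * f (a * (φ h)⁻¹)) := by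
          rw [Finset.sum_comm]
          exact Finset.sum_congr rfl fun h _ => Finset.sum_comm
      _ = ∑ h', ∑ h, Z h * Z h' * corr f (φ (h * h'⁻¹)) := by
          rw [Finset.sum_comm]
          refine Finset.sum_congr rfl fun h' _ => Finset.sum_congr rfl fun h _ => ?_
          rw [← Finset.mul_sum, sum_translate_mul_translate, ← corr_inv f (φ (h * h'⁻¹))]
          simp
      _ = ∑ h', ∑ g, Z (g * h') * Z h' * corr f (φ g) := by
          refine Finset.sum_congr rfl fun h' _ => ?_
          rw [← Equiv.sum_comp (Equiv.mulRight h')]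
          simp
      _ = _ := by
          rw [Finset.sum_comm]
          simp_rw [Finset.sum_mul]
  rw [← key]
  positivity

theorem sum_list_indicator_mul {ι : Type*} [Fintype ι] [DecidableEq ι] (L : List (ℤ × ι))
    (F : ι → ℝ) :
    ∑ h, ((L.map fun q => if h = q.2 then q.1 else 0).sum : ℤ) * F h
      = (L.map fun q => (q.1 : ℝ) * F q.2).sum := by
  induction L with
  | nil => simp
  | cons q L ih =>
    simp only [List.map_cons, List.sum_cons, Int.cast_add, add_mul, Finset.sum_add_distrib, ih]
    simp [ite_mul]

/-- If a finitely supported integral element `Z` of the group algebra, with coefficients given by the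
list `L`, satisfies `Z * star Z = m Z`, then it is nonnegative on autocorrelations. -/
theorem list_sum_corr_nonneg [DecidableEq H] (φ : H →* G) (L : List (ℤ × H)) (Z : H → ℤ) (m : ℤ)
    (hm : 0 < m)
    (hL : ∀ h, Z h = (L.map fun q => if h = q.2 then q.1 else 0).sum)
    (hZ : ∀ g, (L.map fun q => q.1 * Z (g * q.2)).sum = m * Z g) (f : G → ℝ) :
    0 ≤ (L.map fun q => (q.1 : ℝ) * corr f (φ q.2)).sum := by
  have h1 := sum_convolution_mul_corr_nonneg φ (fun h => (Z h : ℝ)) f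
  have h2 : ∀ g, ∑ h, (Z (g * h) : ℝ) * Z h = m * Z g := by
    intro g
    have := sum_list_indicator_mul L (fun h => (Z (g * h) : ℝ))
    simp only [← hL] at this
    simp only [mul_comm (Z (g * _) : ℝ)]
    rw [this]
    have h3 := hZ g
    rw [← Int.cast_mul, ← h3, Int.cast_list_sum, List.map_map]
    congr 1
    simp [Function.comp_def]
  have h4 := sum_list_indicator_mul L (fun h => corr f (φ h))
  simp only [← hL] at h4
  simp only [h2, mul_assoc, ← Finset.mul_sum, h4] at h1
  have : (0 : ℝ) < m := by exact_mod_cast hm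
  exact nonneg_of_mul_nonneg_right h1 this

end Correlation

/-! ### Explicit idempotents in the group algebras of `S₅` and `S₄` -/

theorem viaEmbeddingHom_swap {A B : Type*} [DecidableEq A] [DecidableEq B] (p : A ↪ B) (a b : A) :
    Perm.viaEmbeddingHom p (swap a b) = swap (p a) (p b) := by
  ext x
  rw [Perm.viaEmbeddingHom_apply]
  by_cases hx : x ∈ Set.range p
  · obtain ⟨y, rfl⟩ := hx
    rw [Perm.viaEmbedding_apply, p.injective.map_swap]
  · rw [Perm.viaEmbedding_apply_of_notMem _ _ _ hx, swap_apply_of_ne_of_ne]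
    · rintro rfl; exact hx ⟨a, rfl⟩
    · rintro rfl; exact hx ⟨b, rfl⟩

/-- The two products are inverse to each other. -/
theorem corr_swap_mul_swap_comm {V : Type*} [Fintype V] [DecidableEq V] (f : Perm V → ℝ)
    (a b c d : V) : corr f (swap a b * swap c d) = corr f (swap c d * swap a b) := by
  rw [← corr_inv f (swap c d * swap a b), mul_inv_rev, swap_inv, swap_inv]

theorem swap_mul_swap_eq {A : Type*} [DecidableEq A] {x i j : A} (hj : j ≠ x)
    (hij : i ≠ j) : swap x i * swap x j = swap i j * swap x i := by
  rw [mul_swap_eq_swap_mul, swap_apply_left, swap_apply_of_ne_of_ne hj hij.symm]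

/-- The indicator of equality, used to count fixed points. -/
def fixIndicator {m : ℕ} (a b : Fin m) : ℕ := if a = b then 1 else 0

/-- Twelve times the idempotent of the group algebra of `S₅` whose positivity is used for four legs
of an octopus; the arguments are the values of the permutation. -/
def coeffFive (a b c d e : Fin 5) : ℤ :=
  if a = 0 then
    if b = 1 ∧ c = 2 ∧ d = 3 ∧ e = 4 then 3
    else if (b = 2 ∧ c = 1 ∧ d = 4 ∧ e = 3) ∨ (b = 3 ∧ c = 4 ∧ d = 1 ∧ e = 2) ∨
      (b = 4 ∧ c = 3 ∧ d = 2 ∧ e = 1) then -1 else 0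
  else if fixIndicator b 1 + fixIndicator c 2 + fixIndicator d 3 + fixIndicator e 4 = 2 then -1
  else if fixIndicator b 1 + fixIndicator c 2 + fixIndicator d 3 + fixIndicator e 4 = 1 ∧
    ((a = 1 ∧ b = 0) ∨ (a = 2 ∧ c = 0) ∨ (a = 3 ∧ d = 0) ∨ (a = 4 ∧ e = 0)) then 1
  else 0

/-- The support of `coeffFive`, with the coefficients. -/
def termsFive : List (ℤ × Perm (Fin 5)) :=
  [(3, 1), (-1, swap 0 1 * swap 0 2), (-1, swap 0 1 * swap 0 3), (-1, swap 0 1 * swap 0 4),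
   (-1, swap 0 2 * swap 0 1), (-1, swap 0 2 * swap 0 3), (-1, swap 0 2 * swap 0 4), (-1, swap 0 3 * swap 0 1),
   (-1, swap 0 3 * swap 0 2), (-1, swap 0 3 * swap 0 4), (-1, swap 0 4 * swap 0 1), (-1, swap 0 4 * swap 0 2),
   (-1, swap 0 4 * swap 0 3), (1, swap 0 1 * swap 2 3), (1, swap 0 1 * swap 2 4), (1, swap 0 1 * swap 3 4),
   (1, swap 0 2 * swap 1 3), (1, swap 0 2 * swap 1 4), (1, swap 0 2 * swap 3 4), (1, swap 0 3 * swap 1 2),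
   (1, swap 0 3 * swap 1 4), (1, swap 0 3 * swap 2 4), (1, swap 0 4 * swap 1 2), (1, swap 0 4 * swap 1 3),
   (1, swap 0 4 * swap 2 3), (-1, swap 1 2 * swap 3 4), (-1, swap 1 3 * swap 2 4), (-1, swap 1 4 * swap 2 3)]

/-- The convolution square of `coeffFive`. -/
def coeffFiveConvolution (a b c d e : Fin 5) : ℤ :=
  3 * coeffFive a b c d e - coeffFive c a b d e - coeffFive d a c b e
     - coeffFive e a c d b - coeffFive b c a d e - coeffFive d b a c e
     - coeffFive e b a d c - coeffFive b d c a e - coeffFive c b d a e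
     - coeffFive e b c a d - coeffFive b e c d a - coeffFive c b e d a
     - coeffFive d b c e a + coeffFive b a d c e + coeffFive b a e d c
     + coeffFive b a c e d + coeffFive c d a b e + coeffFive c e a d b
     + coeffFive c b a e d + coeffFive d c b a e + coeffFive d e c a b
     + coeffFive d b e a c + coeffFive e c b d a + coeffFive e d c b a
     + coeffFive e b d c a - coeffFive a c b e d - coeffFive a d e b c
     - coeffFive a e d c b

theorem termsFive_coeff : ∀ h : Perm (Fin 5), coeffFive (h 0) (h 1) (h 2) (h 3) (h 4) =
    (termsFive.map fun q => if h = q.2 then q.1 else 0).sum := by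
  decide +kernel

set_option maxRecDepth 100000 in
set_option synthInstance.maxSize 2000 in
set_option synthInstance.maxHeartbeats 400000 in
-- Stated on tuples of values, with the disequalities interleaved, so that the kernel evaluation
-- discards non-injective tuples early.
theorem coeffFiveConvolution_eq : ∀ a b : Fin 5, a ≠ b → ∀ c, a ≠ c → b ≠ c →
    ∀ d, a ≠ d → b ≠ d → c ≠ d → ∀ e, a ≠ e → b ≠ e → c ≠ e → d ≠ e →
    coeffFiveConvolution a b c d e = 12 * coeffFive a b c d e := by
  decide +kernel

theorem termsFive_convolution (g : Perm (Fin 5)) :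
    (termsFive.map fun q => q.1 * (fun h : Perm (Fin 5) =>
      coeffFive (h 0) (h 1) (h 2) (h 3) (h 4)) (g * q.2)).sum =
      12 * (fun h : Perm (Fin 5) => coeffFive (h 0) (h 1) (h 2) (h 3) (h 4)) g := by
  have h := coeffFiveConvolution_eq (g 0) (g 1) (g.injective.ne (by decide))
    (g 2) (g.injective.ne (by decide)) (g.injective.ne (by decide))
    (g 3) (g.injective.ne (by decide)) (g.injective.ne (by decide)) (g.injective.ne (by decide))
    (g 4) (g.injective.ne (by decide)) (g.injective.ne (by decide)) (g.injective.ne (by decide))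
      (g.injective.ne (by decide))
  refine Eq.trans ?_ h
  simp only [termsFive, List.map_cons, List.map_nil, List.sum_cons, List.sum_nil,
    Perm.mul_apply, Perm.one_apply, coeffFiveConvolution]
  have e1 : ∀ a b c : Fin 5, swap a b c = if c = a then b else if c = b then a else c :=
    fun a b c => swap_apply_def a b c
  simp [e1]
  ring

/-- The `S₅` idempotent is transported along the embedding of the five points. Each 3-cycle through
`x` occurs together with its inverse, hence the factors 2. -/
theorem corr_five_nonneg {V : Type*} [Fintype V] [DecidableEq V] (f : Perm V → ℝ)
    (x i j k l : V) (hp : Function.Injective ![x, i, j, k, l]) :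
    0 ≤ 3 * corr f 1 - 2 * corr f (swap x i * swap x j) - 2 * corr f (swap x i * swap x k)
      - 2 * corr f (swap x i * swap x l) - 2 * corr f (swap x j * swap x k)
      - 2 * corr f (swap x j * swap x l) - 2 * corr f (swap x k * swap x l)
      + corr f (swap x i * swap j k) + corr f (swap x i * swap j l)
      + corr f (swap x i * swap k l) + corr f (swap x j * swap i k)
      + corr f (swap x j * swap i l) + corr f (swap x j * swap k l)
      + corr f (swap x k * swap i j) + corr f (swap x k * swap i l)
      + corr f (swap x k * swap j l) + corr f (swap x l * swap i j)
      + corr f (swap x l * swap i k) + corr f (swap x l * swap j k)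
      - corr f (swap i j * swap k l) - corr f (swap i k * swap j l)
      - corr f (swap i l * swap j k) := by
  have h := list_sum_corr_nonneg (Perm.viaEmbeddingHom ⟨![x, i, j, k, l], hp⟩) termsFive _ 12
    (by norm_num) termsFive_coeff termsFive_convolution f
  have hinv := corr_swap_mul_swap_comm f
  simp only [termsFive, List.map_cons, List.map_nil, List.sum_cons, List.sum_nil, map_mul, map_one,
    viaEmbeddingHom_swap, Function.Embedding.coeFn_mk] at h
  simp at h
  linarith [hinv x i x j, hinv x i x k, hinv x i x l, hinv x j x k, hinv x j x l, hinv x k x l]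

/-- Twelve times the idempotent of the group algebra of `S₄` whose positivity is used for three legs
of an octopus; the arguments are the values of the permutation. -/
def coeffFour (a b c d : Fin 4) : ℤ :=
  let m := fixIndicator a 0 + fixIndicator b 1 + fixIndicator c 2 + fixIndicator d 3
  if m = 4 then 2 else if m = 1 then -1
  else if m = 0 ∧ ((a = 1 ∧ b = 0) ∨ (a = 2 ∧ c = 0) ∨ (a = 3 ∧ d = 0)) then 2
  else 0

/-- The support of `coeffFour`, with the coefficients. -/
def termsFour : List (ℤ × Perm (Fin 4)) :=
  [(2, 1), (2, swap 0 1 * swap 2 3), (2, swap 0 2 * swap 1 3), (2, swap 0 3 * swap 1 2),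
   (-1, swap 0 1 * swap 0 2), (-1, swap 0 1 * swap 0 3), (-1, swap 0 2 * swap 0 1), (-1, swap 0 2 * swap 0 3),
   (-1, swap 0 3 * swap 0 1), (-1, swap 0 3 * swap 0 2), (-1, swap 1 2 * swap 1 3), (-1, swap 1 3 * swap 1 2)]

/-- The convolution square of `coeffFour`. -/
def coeffFourConvolution (a b c d : Fin 4) : ℤ :=
  2 * coeffFour a b c d + 2 * coeffFour b a d c + 2 * coeffFour c d a b
     + 2 * coeffFour d c b a - coeffFour c a b d - coeffFour d a c b
     - coeffFour b c a d - coeffFour d b a c - coeffFour b d c a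
     - coeffFour c b d a - coeffFour a d b c - coeffFour a c d b

theorem termsFour_coeff : ∀ h : Perm (Fin 4), coeffFour (h 0) (h 1) (h 2) (h 3) =
    (termsFour.map fun q => if h = q.2 then q.1 else 0).sum := by
  decide +kernel

set_option maxRecDepth 100000 in
set_option synthInstance.maxSize 2000 in
set_option synthInstance.maxHeartbeats 400000 in
theorem coeffFourConvolution_eq : ∀ a b : Fin 4, a ≠ b → ∀ c, a ≠ c → b ≠ c →
    ∀ d, a ≠ d → b ≠ d → c ≠ d →
    coeffFourConvolution a b c d = 12 * coeffFour a b c d := by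
  decide +kernel

theorem termsFour_convolution (g : Perm (Fin 4)) :
    (termsFour.map fun q => q.1 * (fun h : Perm (Fin 4) =>
      coeffFour (h 0) (h 1) (h 2) (h 3)) (g * q.2)).sum =
      12 * (fun h : Perm (Fin 4) => coeffFour (h 0) (h 1) (h 2) (h 3)) g := by
  have h := coeffFourConvolution_eq (g 0) (g 1) (g.injective.ne (by decide))
    (g 2) (g.injective.ne (by decide)) (g.injective.ne (by decide))
    (g 3) (g.injective.ne (by decide)) (g.injective.ne (by decide)) (g.injective.ne (by decide))
  refine Eq.trans ?_ h
  simp only [termsFour, List.map_cons, List.map_nil, List.sum_cons, List.sum_nil,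
    Perm.mul_apply, Perm.one_apply, coeffFourConvolution]
  have e1 : ∀ a b c : Fin 4, swap a b c = if c = a then b else if c = b then a else c :=
    fun a b c => swap_apply_def a b c
  simp [e1]
  ring

/-- Same argument with the `S₄` idempotent, where all eight 3-cycles pair off with their inverses.
-/
theorem corr_four_nonneg {V : Type*} [Fintype V] [DecidableEq V] (f : Perm V → ℝ)
    (x i j k : V) (hp : Function.Injective ![x, i, j, k]) :
    0 ≤ 2 * corr f 1 + 2 * corr f (swap x i * swap j k) + 2 * corr f (swap x j * swap i k)
      + 2 * corr f (swap x k * swap i j) - 2 * corr f (swap x i * swap x j)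
      - 2 * corr f (swap x i * swap x k) - 2 * corr f (swap x j * swap x k)
      - 2 * corr f (swap i j * swap i k) := by
  have h := list_sum_corr_nonneg (Perm.viaEmbeddingHom ⟨![x, i, j, k], hp⟩) termsFour _ 12
    (by norm_num) termsFour_coeff termsFour_convolution f
  have hinv := corr_swap_mul_swap_comm f
  simp only [termsFour, List.map_cons, List.map_nil, List.sum_cons, List.sum_nil, map_mul, map_one,
    viaEmbeddingHom_swap, Function.Embedding.coeFn_mk] at h
  simp at h
  linarith [hinv x i x j, hinv x i x k, hinv x j x k, hinv i j i k]

/-! ### The octopus inequality -/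

section Octopus

variable {α : Type*} [Fintype α] [DecidableEq α]

theorem sum_swap_mul_swap {V : Type*} [Fintype V] [DecidableEq V] (f : Perm V → ℝ)
    (a b c d : V) :
    ∑ η, f (η * swap a b) * f (η * swap c d) = corr f (swap a b * swap c d) := by
  rw [sum_translate_mul_translate, swap_inv]

/-- The coefficient of `c i * c j` in the rate sum of an octopus with head `none`. -/
noncomputable def octopusRate (i j : α) : ℝ := if i = j then 1 else 1 / 2

/-- The coefficient of `c i * c j` in the off-diagonal part of the octopus operator. -/
noncomputable def octopusTerm (f : Perm (Option α) → ℝ) (i j : α) (η : Perm (Option α)) : ℝ :=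
  (if i = j then 0 else 1 / 2) * f (η * swap (some i) (some j))
    - 1 / 2 * f (η * swap none (some i)) - 1 / 2 * f (η * swap none (some j))

omit [Fintype α] in
theorem octopusRate_comm (i j : α) : octopusRate i j = octopusRate j i := by
  simp only [octopusRate, eq_comm]

omit [Fintype α] in
theorem octopusTerm_comm (f : Perm (Option α) → ℝ) (i j : α) :
    octopusTerm f i j = octopusTerm f j i := by
  funext η
  simp only [octopusTerm, eq_comm (a := i), swap_comm (some i)]
  ring

/-- The coefficient of `c i * c j * c k * c l`, symmetrized over the three pairings. -/
noncomputable def octopusForm (f : Perm (Option α) → ℝ) (i j k l : α) : ℝ :=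
  (octopusRate i j * octopusRate k l + octopusRate i k * octopusRate j l
      + octopusRate i l * octopusRate j k) * corr f 1
    - (∑ η, octopusTerm f i j η * octopusTerm f k l η
      + ∑ η, octopusTerm f i k η * octopusTerm f j l η
      + ∑ η, octopusTerm f i l η * octopusTerm f j k η)

/-- With the next two lemmas: invariance under adjacent transpositions, hence under all permutations
of the indices. -/
theorem octopusForm_swap_left (f : Perm (Option α) → ℝ) (i j k l : α) :
    octopusForm f i j k l = octopusForm f j i k l := by
  simp only [octopusForm, octopusRate_comm j i, octopusTerm_comm f j i,
    mul_comm (octopusTerm f i l _), mul_comm (octopusTerm f i k _)]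
  ring

theorem octopusForm_swap_mid (f : Perm (Option α) → ℝ) (i j k l : α) :
    octopusForm f i j k l = octopusForm f i k j l := by
  simp only [octopusForm, octopusRate_comm j k, octopusTerm_comm f j k]
  ring

theorem octopusForm_swap_right (f : Perm (Option α) → ℝ) (i j k l : α) :
    octopusForm f i j k l = octopusForm f i j l k := by
  simp only [octopusForm, octopusRate_comm k l, octopusTerm_comm f k l]
  ring

theorem sum_octopusTerm_mul (f : Perm (Option α) → ℝ) (i j k l : α) :
    ∑ η, octopusTerm f i j η * octopusTerm f k l η =
      (if i = j then 0 else 1 / 2) * (if k = l then 0 else 1 / 2)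
          * corr f (swap (some i) (some j) * swap (some k) (some l))
        - 1 / 2 * (if i = j then 0 else 1 / 2)
          * (corr f (swap (some i) (some j) * swap none (some k))
            + corr f (swap (some i) (some j) * swap none (some l)))
        - 1 / 2 * (if k = l then 0 else 1 / 2)
          * (corr f (swap (some k) (some l) * swap none (some i))
            + corr f (swap (some k) (some l) * swap none (some j)))
        + 1 / 4 * (corr f (swap none (some i) * swap none (some k))
            + corr f (swap none (some i) * swap none (some l))
            + corr f (swap none (some j) * swap none (some k))
            + corr f (swap none (some j) * swap none (some l))) := by
  simp only [corr_swap_mul_swap_comm f (some k) (some l) none]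
  simp only [← sum_swap_mul_swap, Finset.mul_sum, ← Finset.sum_add_distrib,
    ← Finset.sum_sub_distrib, octopusTerm]
  refine Finset.sum_congr rfl fun η _ => ?_
  ring

theorem corr_swap_cycle {V : Type*} [Fintype V] [DecidableEq V] (f : Perm V → ℝ) {x i j : V}
    (hj : j ≠ x) (hij : i ≠ j) :
    corr f (swap i j * swap x i) = corr f (swap x i * swap x j) := by
  rw [swap_mul_swap_eq hj hij]

/-- With at most two distinct indices every contribution cancels and the form is zero. With three it
is a quarter of the expression in `corr_four_nonneg`. -/
theorem octopusForm_self_nonneg (f : Perm (Option α) → ℝ) (i k l : α) :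
    0 ≤ octopusForm f i i k l := by
  have cyc : ∀ a b : α, a ≠ b → corr f (swap (some a) (some b) * swap none (some a))
      = corr f (swap none (some a) * swap none (some b)) := fun a b hab =>
    corr_swap_cycle f (by simp) (by simpa using hab)
  have cyc' : ∀ a b : α, a ≠ b → corr f (swap (some a) (some b) * swap none (some b))
      = corr f (swap none (some a) * swap none (some b)) := fun a b hab => by
    rw [swap_comm (some a), cyc b a hab.symm, corr_swap_mul_swap_comm]
  have comm := fun a b : α => corr_swap_mul_swap_comm f none (some a) none (some b)
  by_cases hkl : k = l
  · subst hkl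
    by_cases hik : i = k
    · subst hik
      simp only [octopusForm, sum_octopusTerm_mul, octopusRate, if_true, swap_mul_self]
      linarith
    · simp only [octopusForm, sum_octopusTerm_mul, octopusRate, if_true, swap_mul_self, hik,
        if_false, cyc i k hik, cyc' i k hik, comm k i]
      linarith
  by_cases hik : i = k
  · subst hik
    simp only [octopusForm, sum_octopusTerm_mul, octopusRate, if_true, swap_mul_self, hkl,
        if_false, cyc i l hkl, comm l i]
    linarith
  by_cases hil : i = l
  · subst hil
    simp only [octopusForm, sum_octopusTerm_mul, octopusRate, if_true, swap_mul_self, hkl, hik,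
        if_false, cyc i k hik, comm k i, swap_comm (some k) (some i)]
    linarith
  have h := corr_four_nonneg f none (some i) (some k) (some l) (by
    rw [← List.nodup_ofFn]
    simp [hik, hil, hkl])
  simp only [octopusForm, sum_octopusTerm_mul, octopusRate, if_true, swap_mul_self, hkl, hik, hil,
    if_false, cyc i k hik, cyc i l hil, comm k i, comm l i, comm l k]
  have e1 := corr_swap_mul_swap_comm f (some k) (some l) none (some i)
  have e2 := corr_swap_mul_swap_comm f (some i) (some k) none (some l)
  have e3 := corr_swap_mul_swap_comm f (some i) (some l) none (some k)
  have e4 := corr_swap_mul_swap_comm f (some i) (some k) (some i) (some l)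
  linarith

/-- By symmetry any coincidence of indices can be moved to the first two places. For distinct
indices the form is a quarter of the expression in `corr_five_nonneg`. -/
theorem octopusForm_nonneg (f : Perm (Option α) → ℝ) (i j k l : α) :
    0 ≤ octopusForm f i j k l := by
  by_cases hij : i = j
  · subst hij; exact octopusForm_self_nonneg f i k l
  by_cases hik : i = k
  · subst hik
    rw [octopusForm_swap_mid]; exact octopusForm_self_nonneg f i j l
  by_cases hil : i = l
  · subst hil
    rw [octopusForm_swap_right, octopusForm_swap_mid]; exact octopusForm_self_nonneg f i j k
  by_cases hjk : j = k
  · subst hjk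
    rw [octopusForm_swap_left, octopusForm_swap_mid]; exact octopusForm_self_nonneg f j i l
  by_cases hjl : j = l
  · subst hjl
    rw [octopusForm_swap_right, octopusForm_swap_left, octopusForm_swap_mid]
    exact octopusForm_self_nonneg f j i k
  by_cases hkl : k = l
  · subst hkl
    rw [octopusForm_swap_mid, octopusForm_swap_left, octopusForm_swap_right, octopusForm_swap_mid]
    exact octopusForm_self_nonneg f k i j
  have h := corr_five_nonneg f none (some i) (some j) (some k) (some l) (by
    rw [← List.nodup_ofFn]
    simp [hij, hik, hil, hjk, hjl, hkl])
  simp only [octopusForm, sum_octopusTerm_mul, octopusRate, hij, hik, hil, hjk, hjl, hkl,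
    if_false]
  simp only [corr_swap_mul_swap_comm f none _ (some _) (some _)] at h
  have comm := fun a b : α => corr_swap_mul_swap_comm f none (some a) none (some b)
  linarith [comm i j, comm i k, comm i l, comm j k, comm j l, comm k l]

omit [DecidableEq α] in
theorem sum_four_rotate (F : α → α → α → α → ℝ) :
    (∑ i, ∑ j, ∑ k, ∑ l, F i k j l = ∑ i, ∑ j, ∑ k, ∑ l, F i j k l) ∧
    (∑ i, ∑ j, ∑ k, ∑ l, F i l j k = ∑ i, ∑ j, ∑ k, ∑ l, F i j k l) := by
  constructor
  · exact Finset.sum_congr rfl fun i _ => Finset.sum_comm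
  · refine Finset.sum_congr rfl fun i _ => ?_
    calc ∑ j, ∑ k, ∑ l, F i l j k = ∑ j, ∑ l, ∑ k, F i l j k :=
          Finset.sum_congr rfl fun j _ => Finset.sum_comm
      _ = _ := Finset.sum_comm

/-- The squared norm of the off-diagonal part of the octopus operator is controlled by the rates. -/
theorem sum_sq_octopus_le (c : α → ℝ) (hc : ∀ i, 0 ≤ c i) (f : Perm (Option α) → ℝ) :
    ∑ η, (∑ i, ∑ j, c i * c j * octopusTerm f i j η) ^ 2
      ≤ (∑ i, ∑ j, c i * c j * octopusRate i j) ^ 2 * corr f 1 := by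
  let F : α → α → α → α → ℝ := fun i j k l => c i * c j * c k * c l *
    (octopusRate i j * octopusRate k l * corr f 1
      - ∑ η, octopusTerm f i j η * octopusTerm f k l η)
  have hF : (∑ i, ∑ j, c i * c j * octopusRate i j) ^ 2 * corr f 1
      - ∑ η, (∑ i, ∑ j, c i * c j * octopusTerm f i j η) ^ 2
      = ∑ i, ∑ j, ∑ k, ∑ l, F i j k l := by
    have h1 : ∀ u : α → α → ℝ, (∑ i, ∑ j, u i j) ^ 2 = ∑ i, ∑ j, ∑ k, ∑ l, u i j * u k l := by
      intro u
      rw [sq, Finset.sum_mul]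
      refine Finset.sum_congr rfl fun i _ => ?_
      rw [Finset.sum_mul]
      simp only [Finset.mul_sum]
    have h2 : ∑ η, (∑ i, ∑ j, c i * c j * octopusTerm f i j η) ^ 2
        = ∑ i, ∑ j, ∑ k, ∑ l, ∑ η,
          (c i * c j * octopusTerm f i j η) * (c k * c l * octopusTerm f k l η) := by
      simp only [h1]
      rw [Finset.sum_comm]
      refine Finset.sum_congr rfl fun i _ => ?_
      rw [Finset.sum_comm]
      refine Finset.sum_congr rfl fun j _ => ?_
      rw [Finset.sum_comm]
      refine Finset.sum_congr rfl fun k _ => ?_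
      rw [Finset.sum_comm]
    rw [h2, h1]
    simp only [Finset.sum_mul, ← Finset.sum_sub_distrib]
    refine Finset.sum_congr rfl fun i _ => Finset.sum_congr rfl fun j _ =>
      Finset.sum_congr rfl fun k _ => Finset.sum_congr rfl fun l _ => ?_
    simp only [F, mul_sub, Finset.mul_sum]
    congr 1
    · ring
    · exact Finset.sum_congr rfl fun η _ => by ring
  -- The monomial in `c` is symmetric in the indices, so the coefficient may be summed over the
  -- three pairings; this total is `octopusForm`.
  have h3 : 0 ≤ ∑ i, ∑ j, ∑ k, ∑ l, (F i j k l + F i k j l + F i l j k) := by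
    refine Finset.sum_nonneg fun i _ => Finset.sum_nonneg fun j _ => Finset.sum_nonneg fun k _ =>
      Finset.sum_nonneg fun l _ => ?_
    have : F i j k l + F i k j l + F i l j k = c i * c j * c k * c l * octopusForm f i j k l := by
      simp only [F, octopusForm]
      ring
    rw [this]
    have := octopusForm_nonneg f i j k l
    have := hc i; have := hc j; have := hc k; have := hc l
    positivity
  simp only [Finset.sum_add_distrib] at h3
  rw [(sum_four_rotate F).1, (sum_four_rotate F).2] at h3
  linarith

/-- Cauchy–Schwarz with `sum_sq_octopus_le` bounds `⟨f, T f⟩` in absolute value by `a ‖f‖²`. -/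
theorem octopus_form_nonneg (c : α → ℝ) (hc : ∀ i, 0 ≤ c i) (f : Perm (Option α) → ℝ) :
    0 ≤ (∑ i, ∑ j, c i * c j * octopusRate i j) * corr f 1
      + ∑ i, ∑ j, c i * c j * ∑ η, f η * octopusTerm f i j η := by
  set a := ∑ i, ∑ j, c i * c j * octopusRate i j with ha
  set T := fun η => ∑ i, ∑ j, c i * c j * octopusTerm f i j η with hT
  have ha0 : 0 ≤ a := Finset.sum_nonneg fun i _ => Finset.sum_nonneg fun j _ => by
    have := hc i; have := hc j
    have : 0 ≤ octopusRate i j := by unfold octopusRate; split_ifs <;> norm_num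
    positivity
  have h1 : ∑ i, ∑ j, c i * c j * ∑ η, f η * octopusTerm f i j η = ∑ η, f η * T η := by
    simp only [hT, Finset.mul_sum]
    symm
    rw [Finset.sum_comm]
    refine Finset.sum_congr rfl fun i _ => ?_
    rw [Finset.sum_comm]
    exact Finset.sum_congr rfl fun j _ => Finset.sum_congr rfl fun η _ => by ring
  have h2 := sum_sq_octopus_le c hc f
  have h3 := Finset.sum_mul_sq_le_sq_mul_sq Finset.univ f T
  have hk : corr f 1 = ∑ η, f η ^ 2 := corr_one f
  have hk0 : 0 ≤ corr f 1 := by rw [hk]; positivity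
  rw [h1]
  have h4 : (∑ η, f η * T η) ^ 2 ≤ (a * corr f 1) ^ 2 := by
    refine h3.trans ?_
    rw [← hk, mul_pow, sq (corr f 1)]
    nlinarith
  have h5 := abs_le_of_sq_le_sq h4 (by positivity)
  linarith [(abs_le.1 h5).1]

/-- The Dirichlet form of a single transposition on the symmetric group. -/
def swapEnergy {V : Type*} [Fintype V] [DecidableEq V] (f : Perm V → ℝ) (x y : V) : ℝ :=
  ∑ η, (f η - f (η * swap x y)) ^ 2

theorem swapEnergy_eq {V : Type*} [Fintype V] [DecidableEq V] (f : Perm V → ℝ) (x y : V) :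
    swapEnergy f x y = 2 * corr f 1 - 2 * corr f (swap x y) := by
  have h : ∑ η, f (η * swap x y) ^ 2 = corr f 1 := by
    simp only [sq, sum_swap_mul_swap, swap_mul_self]
  calc swapEnergy f x y = ∑ η, (f η ^ 2 + f (η * swap x y) ^ 2 - 2 * (f η * f (η * swap x y))) :=
        Finset.sum_congr rfl fun η _ => by ring
    _ = _ := by
      rw [Finset.sum_sub_distrib, Finset.sum_add_distrib, h, ← corr_one, ← Finset.mul_sum, corr]
      simp only [corr]
      ring

/-- The octopus inequality. -/
theorem octopus_inequality (c : α → ℝ) (hc : ∀ i, 0 ≤ c i) (f : Perm (Option α) → ℝ) :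
    1 / 2 * ∑ i, ∑ j, c i * c j * swapEnergy f (some i) (some j)
      ≤ (∑ i, c i) * ∑ i, c i * swapEnergy f none (some i) := by
  have h := octopus_form_nonneg c hc f
  have e : (∑ i, c i) * ∑ i, c i * swapEnergy f none (some i)
      = 1 / 2 * ∑ i, ∑ j, c i * c j * (swapEnergy f none (some i) + swapEnergy f none (some j)) := by
    simp only [mul_add, Finset.sum_add_distrib]
    have e1 : ∑ i, ∑ j, c i * c j * swapEnergy f none (some j)
        = (∑ i, c i) * ∑ i, c i * swapEnergy f none (some i) := by
      simp only [Finset.sum_mul_sum, mul_assoc]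
    have e2 : ∑ i, ∑ j, c i * c j * swapEnergy f none (some i)
        = (∑ i, c i) * ∑ i, c i * swapEnergy f none (some i) := by
      rw [← e1, Finset.sum_comm]
      exact Finset.sum_congr rfl fun i _ => Finset.sum_congr rfl fun j _ => by ring
    rw [e1, e2]; ring
  rw [e]
  have key : 1 / 2 * ∑ i, ∑ j, c i * c j * (swapEnergy f none (some i) + swapEnergy f none (some j))
      - 1 / 2 * ∑ i, ∑ j, c i * c j * swapEnergy f (some i) (some j)
      = 2 * ((∑ i, ∑ j, c i * c j * octopusRate i j) * corr f 1
      + ∑ i, ∑ j, c i * c j * ∑ η, f η * octopusTerm f i j η) := by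
    simp only [Finset.sum_mul, Finset.mul_sum (Finset.univ : Finset α), ← Finset.sum_sub_distrib,
      ← Finset.sum_add_distrib]
    refine Finset.sum_congr rfl fun i _ => Finset.sum_congr rfl fun j _ => ?_
    have e3 : ∑ η, f η * octopusTerm f i j η
        = (if i = j then 0 else 1 / 2) * corr f (swap (some i) (some j))
          - 1 / 2 * corr f (swap none (some i)) - 1 / 2 * corr f (swap none (some j)) := by
      simp only [corr, Finset.mul_sum, ← Finset.sum_sub_distrib, octopusTerm]
      exact Finset.sum_congr rfl fun η _ => by ring
    rw [e3]
    simp only [swapEnergy_eq, octopusRate]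
    by_cases hij : i = j
    · subst hij
      simp only [if_true, swap_self, ← Perm.one_def]
      ring
    · simp only [hij, if_false]
      ring
  linarith

end Octopus

/-! ### Spectral gap and Poincaré inequality of symmetric operators -/

section SymmetricOperators

variable {S : Type*} [Fintype S]

/-- Spectral theorem for an operator on functions which is symmetric for the counting measure. -/
theorem exists_eigenbasis (A : (S → ℝ) →ₗ[ℝ] (S → ℝ))
    (hA : ∀ f g, f ⬝ᵥ A g = A f ⬝ᵥ g) :
    ∃ (b : S → S → ℝ) (e : S → ℝ), (∀ i, A (b i) = e i • b i) ∧
      (∀ i, b i ⬝ᵥ b i = 1) ∧ (∀ i j, i ≠ j → b i ⬝ᵥ b j = 0) ∧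
      (∀ f, f = ∑ i, (f ⬝ᵥ b i) • b i) ∧ A.charpoly.roots = Finset.univ.val.map e := by
  classical
  have hM : (LinearMap.toMatrix' A).IsHermitian := by
    ext i j
    have := hA (Pi.single i 1) (Pi.single j 1)
    rw [single_one_dotProduct, dotProduct_single_one] at this
    simp [LinearMap.toMatrix'_apply, this]
  have ho := hM.eigenvectorBasis.orthonormal
  refine ⟨fun i => (hM.eigenvectorBasis i).ofLp, hM.eigenvalues, fun i => ?_, fun i => ?_,
    fun i j hij => ?_, fun f => ?_, ?_⟩
  · have := hM.mulVec_eigenvectorBasis i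
    rwa [LinearMap.toMatrix'_mulVec] at this
  · have := ho.1 i
    have h2 : inner ℝ (hM.eigenvectorBasis i) (hM.eigenvectorBasis i) = (1 : ℝ) := by
      rw [real_inner_self_eq_norm_sq, this]; norm_num
    rw [EuclideanSpace.inner_eq_star_dotProduct] at h2
    simpa using h2
  · have h2 : inner ℝ (hM.eigenvectorBasis i) (hM.eigenvectorBasis j) = (0 : ℝ) := ho.2 hij
    rw [EuclideanSpace.inner_eq_star_dotProduct] at h2
    rw [dotProduct_comm]
    simpa using h2
  · have h := congrArg WithLp.ofLp (hM.eigenvectorBasis.sum_repr (WithLp.toLp 2 f))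
    simp only [WithLp.ofLp_sum, WithLp.ofLp_smul] at h
    refine h.symm.trans (Finset.sum_congr rfl fun i _ => ?_)
    rw [hM.eigenvectorBasis.repr_apply_apply, EuclideanSpace.inner_eq_star_dotProduct]
    simp
  · have h := LinearMap.charpoly_toMatrix A (Pi.basisFun ℝ S)
    rw [LinearMap.toMatrix_eq_toMatrix'] at h
    rw [← h, hM.roots_charpoly_eq_eigenvalues]
    rfl

/-- The operator is modified on constants so that positivity on all functions can be read off from
one eigenbasis, whose members need not have zero sum. -/
theorem poincare_of_eigenvalues_ge (A : (S → ℝ) →ₗ[ℝ] (S → ℝ))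
    (hA : ∀ f g, f ⬝ᵥ A g = A f ⬝ᵥ g) (h1 : A 1 = 0) (μ : ℝ)
    (h : ∀ (ν : ℝ) (f : S → ℝ), f ≠ 0 → ∑ s, f s = 0 → A f = ν • f → μ ≤ ν)
    (f : S → ℝ) (hf : ∑ s, f s = 0) : μ * (f ⬝ᵥ f) ≤ f ⬝ᵥ A f := by
  let J : (S → ℝ) →ₗ[ℝ] (S → ℝ) :=
    { toFun := fun f _ => ∑ s, f s
      map_add' := fun f g => by ext; simp [Finset.sum_add_distrib]
      map_smul' := fun a f => by ext; simp [Finset.mul_sum] }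
  have hJ : ∀ f g : S → ℝ, f ⬝ᵥ J g = (∑ s, f s) * ∑ s, g s := fun f g => by
    simp [dotProduct, J, Finset.sum_mul]
  have hJ' : ∀ f g : S → ℝ, J f ⬝ᵥ g = (∑ s, f s) * ∑ s, g s := fun f g => by
    rw [dotProduct_comm, hJ, mul_comm]
  -- `B` kills constants and equals `A - μ` on functions of zero sum.
  let B := A + (μ / Fintype.card S) • J - μ • LinearMap.id
  have hB : ∀ f g, f ⬝ᵥ B g = B f ⬝ᵥ g := fun f g => by
    simp [B, dotProduct_add, dotProduct_sub, add_dotProduct, sub_dotProduct, hA, hJ, hJ']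
  obtain ⟨b, e, hb, hb1, hb0, hsum, -⟩ := exists_eigenbasis B hB
  have hone : ∀ g : S → ℝ, ∑ s, A g s = 0 := fun g => by
    have := hA 1 g
    rw [h1, zero_dotProduct, one_dotProduct] at this
    exact this
  have he : ∀ i, 0 ≤ e i := by
    intro i
    have hbi : b i ≠ 0 := fun h => by have := hb1 i; simp [h] at this
    by_cases hs : ∑ s, b i s = 0
    · have hAi : A (b i) = (e i + μ) • b i := by
        have h3 := hb i
        have : J (b i) = 0 := by ext; simp [J, hs]
        simp only [B, LinearMap.sub_apply, LinearMap.add_apply, LinearMap.smul_apply, this,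
          LinearMap.id_apply, smul_zero, add_zero] at h3
        rw [add_smul, ← h3]
        abel
      linarith [h _ _ hbi hs hAi]
    -- `B` has range in the functions of zero sum, so an eigenvector with nonzero sum has eigenvalue
    -- 0.
    · have h3 := congrArg (fun g => ∑ s, g s) (hb i)
      have hne : (Fintype.card S : ℝ) ≠ 0 := by
        have : Nonempty S := ⟨i⟩
        exact_mod_cast Fintype.card_ne_zero
      simp [B, Finset.sum_sub_distrib, Finset.sum_add_distrib, hone, ← Finset.mul_sum, J] at h3
      have h4 : e i * ∑ s, b i s = 0 := by
        rw [← h3]; field_simp; ring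
      rcases mul_eq_zero.1 h4 with h5 | h5
      · exact h5.ge
      · exact absurd h5 hs
  have hpos : 0 ≤ f ⬝ᵥ B f := by
    have : f ⬝ᵥ B f = ∑ i, e i * (f ⬝ᵥ b i) ^ 2 := by
      conv_lhs => rw [hsum (B f), dotProduct_sum]
      refine Finset.sum_congr rfl fun i _ => ?_
      rw [dotProduct_smul, ← hB, hb, dotProduct_smul, smul_eq_mul, smul_eq_mul]
      ring
    rw [this]
    exact Finset.sum_nonneg fun i _ => mul_nonneg (he i) (sq_nonneg _)
  simp [B, dotProduct_add, dotProduct_sub, hJ, hf] at hpos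
  linarith

theorem exists_minimal_eigenpair [Nontrivial S] (A : (S → ℝ) →ₗ[ℝ] (S → ℝ))
    (hA : ∀ f g, f ⬝ᵥ A g = A f ⬝ᵥ g) (h1 : A 1 = 0) :
    ∃ (μ : ℝ) (f : S → ℝ), f ≠ 0 ∧ ∑ s, f s = 0 ∧ A f = μ • f ∧
      ∀ g : S → ℝ, ∑ s, g s = 0 → μ * (g ⬝ᵥ g) ≤ g ⬝ᵥ A g := by
  classical
  let E : Set ℝ := {ν | ∃ f : S → ℝ, f ≠ 0 ∧ ∑ s, f s = 0 ∧ A f = ν • f}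
  have hfin : E.Finite := by
    refine (Module.End.finite_hasEigenvalue A).subset ?_
    rintro ν ⟨f, hf, -, hAf⟩
    exact Module.End.hasEigenvalue_of_hasEigenvector (x := f)
      ⟨Module.End.mem_eigenspace_iff.2 hAf, hf⟩
  have hne : E.Nonempty := by
    by_contra hE
    rw [Set.not_nonempty_iff_eq_empty] at hE
    obtain ⟨x, y, hxy⟩ := exists_pair_ne S
    let g : S → ℝ := Pi.single x 1 - Pi.single y 1
    have hg : ∑ s, g s = 0 := by simp [g]
    have hg0 : 0 < g ⬝ᵥ g := by
      have : g ≠ 0 := fun h => by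
        have := congrFun h x
        simp [g, hxy] at this
      have h0 : 0 ≤ g ⬝ᵥ g := Finset.sum_nonneg fun s _ => mul_self_nonneg _
      exact lt_of_le_of_ne h0 fun h => this (dotProduct_self_eq_zero.1 h.symm)
    -- Without eigenvalues the Poincaré inequality would hold for every constant, in particular for
    -- one above the Rayleigh quotient of `g`.
    have := poincare_of_eigenvalues_ge A hA h1 ((g ⬝ᵥ A g + 1) / (g ⬝ᵥ g))
      (fun ν f hf hs hAf => absurd (⟨f, hf, hs, hAf⟩ : ν ∈ E) (Set.eq_empty_iff_forall_notMem.1 hE ν)) g hg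
    rw [div_mul_cancel₀ _ hg0.ne'] at this
    linarith
  obtain ⟨μ, ⟨f, hf, hs, hAf⟩, hmin⟩ := Set.exists_min_image E id hfin hne
  exact ⟨μ, f, hf, hs, hAf, poincare_of_eigenvalues_ge A hA h1 μ
    fun ν g hg hsg hAg => hmin ν ⟨g, hg, hsg, hAg⟩⟩

/-- A min-max argument: one basis index is set aside, all other eigenvalues are at least `μ`, and
one of them equals `μ`. The constants need not be a member of the basis. -/
theorem spectralGap_eq_of_eigenpair (L : (S → ℝ) →ₗ[ℝ] (S → ℝ))
    (hA : ∀ f g, f ⬝ᵥ (-L) g = (-L) f ⬝ᵥ g) (h1 : (-L) 1 = 0) (μ : ℝ) (hμ : 0 ≤ μ)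
    (f : S → ℝ) (hf : f ≠ 0) (hs : ∑ s, f s = 0) (hAf : (-L) f = μ • f)
    (hP : ∀ g : S → ℝ, ∑ s, g s = 0 → μ * (g ⬝ᵥ g) ≤ g ⬝ᵥ (-L) g) :
    spectralGap L = μ := by
  classical
  unfold spectralGap
  generalize -L = A at *
  obtain ⟨b, e, hb, hb1, hb0, hsum, hroots⟩ := exists_eigenbasis A hA
  have hS : Nonempty S := by
    by_contra h
    rw [not_nonempty_iff] at h
    exact hf (Subsingleton.elim _ _)
  obtain ⟨i₀, -, hi₀⟩ := Finset.exists_min_image Finset.univ e Finset.univ_nonempty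
  have hge : ∀ i, i ≠ i₀ → μ ≤ e i := by
    intro i hi
    -- The plane spanned by `b i₀` and `b i` contains a nonzero function of zero sum, to which `hP`
    -- applies.
    have hab : ∀ β γ : ℝ, β * ∑ s, b i₀ s + γ * ∑ s, b i s = 0 →
        μ * (β ^ 2 + γ ^ 2) ≤ e i * (β ^ 2 + γ ^ 2) := by
      intro β γ hβγ
      have hP' := hP (β • b i₀ + γ • b i) (by
        simpa [Finset.sum_add_distrib, ← Finset.mul_sum] using hβγ)
      simp only [map_add, map_smul, hb, dotProduct_add, add_dotProduct, smul_dotProduct,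
        dotProduct_smul, hb1, hb0 i i₀ hi, hb0 i₀ i hi.symm, smul_eq_mul] at hP'
      have := mul_le_mul_of_nonneg_right (hi₀ i (Finset.mem_univ _)) (sq_nonneg β)
      nlinarith
    by_cases hz : ∑ s, b i s = 0
    · have := hab 0 1 (by simp [hz])
      linarith
    · have := hab (∑ s, b i s) (-∑ s, b i₀ s) (by ring)
      refine le_of_mul_le_mul_right this ?_
      have : 0 < (∑ s, b i s) ^ 2 := by positivity
      positivity
  have hcoef : ∀ (g : S → ℝ) (ν : ℝ) (i : S), A g = ν • g → e i ≠ ν → g ⬝ᵥ b i = 0 := by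
    intro g ν i hg hi
    have := hA g (b i)
    rw [hb, hg, dotProduct_smul, smul_dotProduct, smul_eq_mul, smul_eq_mul] at this
    by_contra h
    exact hi (mul_right_cancel₀ h this)
  obtain ⟨i₁, hi₁, he₁⟩ : ∃ i₁, i₁ ≠ i₀ ∧ e i₁ = μ := by
    by_contra! hno
    have hgt : ∀ i, i ≠ i₀ → μ < e i := fun i hi => lt_of_le_of_ne (hge i hi) (hno i hi).symm
    -- Otherwise `f` and the constant 1 would both be multiples of `b i₀`, although they are nonzero
    -- and orthogonal.
    have hexp : ∀ (g : S → ℝ) (ν : ℝ), A g = ν • g → ν ≤ μ → g = (g ⬝ᵥ b i₀) • b i₀ := by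
      intro g ν hg hν
      conv_lhs => rw [hsum g]
      rw [Finset.sum_eq_single i₀]
      · intro i _ hi
        rw [hcoef g ν i hg (by linarith [hgt i hi] : ν < e i).ne', zero_smul]
      · simp
    have e1 := hexp f μ hAf le_rfl
    have e2 := hexp 1 0 (by rw [h1, zero_smul]) hμ
    have e3 : f ⬝ᵥ 1 = 0 := by rw [dotProduct_one, hs]
    rw [e1, e2, smul_dotProduct, dotProduct_smul, hb1] at e3
    simp only [smul_eq_mul, mul_one] at e3
    rcases mul_eq_zero.1 e3 with h | h
    · rw [h, zero_smul] at e1; exact hf e1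
    · rw [h, zero_smul] at e2
      have := congrFun e2 i₀
      simp at this
  have huniv : (Finset.univ : Finset S).val
      = i₀ ::ₘ i₁ ::ₘ ((Finset.univ.erase i₀).erase i₁).val := by
    rw [← Finset.insert_val_of_notMem (Finset.notMem_erase i₁ _), Finset.insert_erase (by simp [hi₁]),
      ← Finset.insert_val_of_notMem (Finset.notMem_erase i₀ _), Finset.insert_erase (by simp)]
  rw [hroots, huniv, Multiset.map_cons, Multiset.map_cons, Multiset.sort_cons, Multiset.sort_cons]
  · simp [he₁]
  · intro x hx
    obtain ⟨i, hi, rfl⟩ := Multiset.mem_map.1 hx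
    rw [he₁]
    refine hge i ?_
    simp only [Finset.mem_val, Finset.mem_erase] at hi
    exact hi.2.1
  · intro x hx
    rw [← Multiset.map_cons] at hx
    obtain ⟨i, -, rfl⟩ := Multiset.mem_map.1 hx
    exact hi₀ i (Finset.mem_univ _)

end SymmetricOperators

/-! ### Chains driven by involutive exchanges -/

section Exchange

variable {V S T : Type*} [Fintype V] [Fintype S] [Fintype T]

/-- Minus the generator of the Markov chain which performs the move `a x y` at rate `w x y` (each
unordered pair being counted twice). -/
noncomputable def exchangeOp (w : V → V → ℝ) (a : V → V → S → S) :
    (S → ℝ) →ₗ[ℝ] (S → ℝ) where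
  toFun f s := 1 / 2 * ∑ x, ∑ y, w x y * (f s - f (a x y s))
  map_add' f g := by
    funext s
    simp only [Pi.add_apply, ← mul_add, ← Finset.sum_add_distrib]
    congr 1
    exact Finset.sum_congr rfl fun x _ => Finset.sum_congr rfl fun y _ => by ring
  map_smul' r f := by
    funext s
    simp only [Pi.smul_apply, smul_eq_mul, RingHom.id_apply, Finset.mul_sum]
    exact Finset.sum_congr rfl fun x _ => Finset.sum_congr rfl fun y _ => by ring

omit [Fintype S] in
theorem exchangeOp_apply (w : V → V → ℝ) (a : V → V → S → S) (f : S → ℝ) (s : S) :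
    exchangeOp w a f s = 1 / 2 * ∑ x, ∑ y, w x y * (f s - f (a x y s)) := rfl

omit [Fintype S] in
theorem exchangeOp_one (w : V → V → ℝ) (a : V → V → S → S) : exchangeOp w a 1 = 0 := by
  funext s
  simp [exchangeOp_apply]

theorem dotProduct_exchangeOp (w : V → V → ℝ) (a : V → V → S → S) (f g : S → ℝ) :
    f ⬝ᵥ exchangeOp w a g
      = 1 / 2 * ∑ x, ∑ y, w x y * (∑ s, f s * g s - ∑ s, f s * g (a x y s)) := by
  simp only [dotProduct, exchangeOp_apply, ← Finset.sum_sub_distrib, Finset.mul_sum]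
  rw [Finset.sum_comm]
  refine Finset.sum_congr rfl fun x _ => ?_
  rw [Finset.sum_comm]
  exact Finset.sum_congr rfl fun y _ => Finset.sum_congr rfl fun s _ => by ring

theorem sum_comp_involutive {a : S → S} (ha : Function.Involutive a) (F : S → ℝ) :
    ∑ s, F (a s) = ∑ s, F s := Equiv.sum_comp ha.toPerm F

theorem exchangeOp_symmetric (w : V → V → ℝ) (a : V → V → S → S)
    (ha : ∀ x y, Function.Involutive (a x y)) (f g : S → ℝ) :
    f ⬝ᵥ exchangeOp w a g = exchangeOp w a f ⬝ᵥ g := by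
  rw [dotProduct_comm (exchangeOp w a f), dotProduct_exchangeOp, dotProduct_exchangeOp]
  congr 1
  refine Finset.sum_congr rfl fun x _ => Finset.sum_congr rfl fun y _ => ?_
  rw [← sum_comp_involutive (ha x y) (fun s => f s * g (a x y s))]
  simp only [ha x y _, mul_comm]

theorem exchangeOp_form (w : V → V → ℝ) (a : V → V → S → S)
    (ha : ∀ x y, Function.Involutive (a x y)) (f : S → ℝ) :
    f ⬝ᵥ exchangeOp w a f = 1 / 4 * ∑ x, ∑ y, w x y * ∑ s, (f s - f (a x y s)) ^ 2 := by
  rw [dotProduct_exchangeOp]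
  simp only [Finset.mul_sum (Finset.univ : Finset V)]
  refine Finset.sum_congr rfl fun x _ => Finset.sum_congr rfl fun y _ => ?_
  have h1 := sum_comp_involutive (ha x y) (fun s => f s ^ 2)
  have h2 : ∑ s, (f s - f (a x y s)) ^ 2
      = ∑ s, f s ^ 2 + ∑ s, f (a x y s) ^ 2 - 2 * ∑ s, f s * f (a x y s) := by
    rw [Finset.mul_sum, ← Finset.sum_add_distrib, ← Finset.sum_sub_distrib]
    exact Finset.sum_congr rfl fun s _ => by ring
  rw [h2, h1]
  simp only [sq]
  ring

omit [Fintype S] in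
-- A kernel equivariant under the moves carries eigenfunctions of one chain to eigenfunctions of the
-- other, or to zero.
theorem exchangeOp_intertwine (w : V → V → ℝ) (a : V → V → S → S) (b : V → V → T → T)
    (hb : ∀ x y, Function.Involutive (b x y)) (K : S → T → ℝ)
    (hK : ∀ x y s t, K (a x y s) t = K s (b x y t)) (f : T → ℝ) :
    exchangeOp w a (fun s => ∑ t, K s t * f t) = fun s => ∑ t, K s t * exchangeOp w b f t := by
  funext s
  simp only [exchangeOp_apply, Finset.mul_sum]
  symm
  rw [Finset.sum_comm]
  refine Finset.sum_congr rfl fun x _ => ?_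
  rw [Finset.sum_comm]
  refine Finset.sum_congr rfl fun y _ => ?_
  have h1 : ∑ t, K (a x y s) t * f t = ∑ t, K s t * f (b x y t) := by
    rw [← sum_comp_involutive (hb x y)]
    simp only [hK, hb x y _]
  rw [h1, ← Finset.sum_sub_distrib, Finset.mul_sum, Finset.mul_sum]
  exact Finset.sum_congr rfl fun t _ => by ring

end Exchange

/-! ### The interchange process inherits the Poincaré inequality of the walk -/

section Interchange

/-- The Dirichlet form of the random walk. -/
noncomputable def walkForm {V : Type*} [Fintype V] (w : V → V → ℝ) (g : V → ℝ) : ℝ :=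
  1 / 2 * ∑ x, ∑ y, w x y * (g x - g y) ^ 2

/-- The Dirichlet form of the interchange process. -/
noncomputable def interchangeForm {V : Type*} [Fintype V] [DecidableEq V] (w : V → V → ℝ)
    (f : Perm V → ℝ) : ℝ :=
  1 / 4 * ∑ x, ∑ y, w x y * swapEnergy f x y

/-- The Poincaré inequality of the random walk with constant `μ`. -/
def WalkPoincare {V : Type*} [Fintype V] (w : V → V → ℝ) (μ : ℝ) : Prop :=
  ∀ g : V → ℝ, ∑ v, g v = 0 → μ * ∑ v, g v ^ 2 ≤ walkForm w g

/-- The Poincaré inequality of the interchange process with constant `μ`. -/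
def InterchangePoincare {V : Type*} [Fintype V] [DecidableEq V] (w : V → V → ℝ) (μ : ℝ) : Prop :=
  ∀ f : Perm V → ℝ, ∑ η, f η = 0 → μ * ∑ η, f η ^ 2 ≤ interchangeForm w f

theorem swap_involutive {V : Type*} [DecidableEq V] (x y : V) :
    Function.Involutive (fun v => swap x y v) := fun v => swap_apply_self x y v

theorem mul_swap_involutive' {V : Type*} [DecidableEq V] (x y : V) :
    Function.Involutive (fun η : Perm V => η * swap x y) := fun η => mul_swap_mul_self x y η

theorem dotProduct_self_eq_sum_sq {S : Type*} [Fintype S] (f : S → ℝ) :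
    f ⬝ᵥ f = ∑ s, f s ^ 2 := by simp [dotProduct, sq]

theorem walkForm_eq {V : Type*} [Fintype V] [DecidableEq V] (w : V → V → ℝ) (g : V → ℝ) :
    g ⬝ᵥ exchangeOp w (fun x y v => swap x y v) g = walkForm w g := by
  rw [exchangeOp_form _ _ (fun x y => swap_involutive x y), walkForm]
  simp only [Finset.mul_sum (Finset.univ : Finset V)]
  refine Finset.sum_congr rfl fun x _ => Finset.sum_congr rfl fun y _ => ?_
  simp only [← Finset.mul_sum]
  have : ∑ v, (g v - g (swap x y v)) ^ 2 = 2 * (g x - g y) ^ 2 := by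
    by_cases hxy : x = y
    · subst hxy; simp
    rw [← Finset.sum_subset (Finset.subset_univ {x, y})]
    · rw [Finset.sum_pair hxy, swap_apply_left, swap_apply_right]; ring
    · intro v _ hv
      simp only [Finset.mem_insert, Finset.mem_singleton, not_or] at hv
      rw [swap_apply_of_ne_of_ne hv.1 hv.2]; ring
  rw [this]; ring

theorem interchangeForm_eq {V : Type*} [Fintype V] [DecidableEq V] (w : V → V → ℝ)
    (f : Perm V → ℝ) :
    f ⬝ᵥ exchangeOp w (fun x y η => η * swap x y) f = interchangeForm w f := by
  rw [exchangeOp_form _ _ (fun x y => mul_swap_involutive' x y)]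
  rfl

/-- The weights of the network reduced by eliminating the vertex `none`. -/
noncomputable def reducedWeight {α : Type*} [Fintype α] (w : Option α → Option α → ℝ) (i j : α) :
    ℝ :=
  w (some i) (some j) + w none (some i) * w none (some j) / ∑ k, w none (some k)

section Reduction

variable {α : Type*} [Fintype α] {w : Option α → Option α → ℝ}

theorem walkForm_option (hw : ∀ x y, w x y = w y x) (g : Option α → ℝ) :
    walkForm w g = 1 / 2 * ∑ i, ∑ j, w (some i) (some j) * (g (some i) - g (some j)) ^ 2
      + ∑ i, w none (some i) * (g none - g (some i)) ^ 2 := by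
  have h : ∀ i, w (some i) none * (g (some i) - g none) ^ 2
      = w none (some i) * (g none - g (some i)) ^ 2 := fun i => by rw [hw]; ring
  simp only [walkForm, Fintype.sum_option, Finset.sum_add_distrib, h]
  ring

theorem interchangeForm_option [DecidableEq α] (hw : ∀ x y, w x y = w y x)
    (f : Perm (Option α) → ℝ) :
    interchangeForm w f = 1 / 4 * ∑ i, ∑ j, w (some i) (some j) * swapEnergy f (some i) (some j)
      + 1 / 2 * ∑ i, w none (some i) * swapEnergy f none (some i) := by
  have h : ∀ i, w (some i) none * swapEnergy f (some i) none
      = w none (some i) * swapEnergy f none (some i) := fun i => by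
    rw [hw]; simp only [swapEnergy, swap_comm]
  have h0 : swapEnergy f none none = 0 := by simp [swapEnergy, ← Perm.one_def]
  simp only [interchangeForm, Fintype.sum_option, Finset.sum_add_distrib, h, h0]
  ring

theorem reducedWeight_nonneg (h0 : ∀ x y, 0 ≤ w x y) (i j : α) : 0 ≤ reducedWeight w i j := by
  have := h0 (some i) (some j)
  have := h0 none (some i)
  have := h0 none (some j)
  have : 0 ≤ ∑ k, w none (some k) := Finset.sum_nonneg fun k _ => h0 _ _
  unfold reducedWeight
  positivity

theorem reducedWeight_comm (hw : ∀ x y, w x y = w y x) (i j : α) :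
    reducedWeight w i j = reducedWeight w j i := by
  rw [reducedWeight, reducedWeight, hw (some i), mul_comm (w none (some i))]

/-- Energy identity of the harmonic extension. -/
theorem harmonic_extension_energy (c g : α → ℝ) (hc : ∀ i, 0 ≤ c i) :
    1 / 2 * ∑ i, ∑ j, c i * c j / (∑ k, c k) * (g i - g j) ^ 2
      = ∑ i, c i * ((∑ k, c k * g k) / (∑ k, c k) - g i) ^ 2 := by
  -- If `none` is isolated, both quotients are 0 by the convention for division, and all `c i`
  -- vanish.
  by_cases hS : ∑ k, c k = 0
  · have := (Finset.sum_eq_zero_iff_of_nonneg (fun i _ => hc i)).1 hS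
    simp at this
    simp [this]
  have e1 : ∑ i, ∑ j, c i * c j / (∑ k, c k) * (g i - g j) ^ 2
      = (2 * (∑ i, c i) * (∑ i, c i * g i ^ 2) - 2 * (∑ i, c i * g i) ^ 2) / ∑ k, c k := by
    have e2 : ∑ i, ∑ j, c i * c j * (g i - g j) ^ 2
        = 2 * (∑ i, c i) * (∑ i, c i * g i ^ 2) - 2 * (∑ i, c i * g i) ^ 2 := by
      have a1 : ∑ i, ∑ j, (c i * g i ^ 2) * c j = (∑ i, c i * g i ^ 2) * ∑ i, c i :=
        (Finset.sum_mul_sum ..).symm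
      have a2 : ∑ i, ∑ j, c i * (c j * g j ^ 2) = (∑ i, c i) * ∑ i, c i * g i ^ 2 :=
        (Finset.sum_mul_sum ..).symm
      have a3 : ∑ i, ∑ j, (c i * g i) * (c j * g j) = (∑ i, c i * g i) * ∑ i, c i * g i :=
        (Finset.sum_mul_sum ..).symm
      calc ∑ i, ∑ j, c i * c j * (g i - g j) ^ 2
          = ∑ i, ∑ j, ((c i * g i ^ 2) * c j + c i * (c j * g j ^ 2)
              - 2 * ((c i * g i) * (c j * g j))) :=
            Finset.sum_congr rfl fun i _ => Finset.sum_congr rfl fun j _ => by ring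
        _ = _ := by
            simp only [Finset.sum_sub_distrib, Finset.sum_add_distrib, ← Finset.mul_sum] at *
            rw [a1, a2, a3]; ring
    rw [← e2, Finset.sum_div]
    refine Finset.sum_congr rfl fun i _ => ?_
    rw [Finset.sum_div]
    exact Finset.sum_congr rfl fun j _ => by ring
  rw [e1]
  generalize hh : (∑ k, c k * g k) / (∑ k, c k) = h
  have e3 : ∑ i, c i * (h - g i) ^ 2
      = h ^ 2 * (∑ i, c i) - 2 * h * (∑ i, c i * g i) + ∑ i, c i * g i ^ 2 := by
    simp only [Finset.mul_sum, ← Finset.sum_sub_distrib, ← Finset.sum_add_distrib]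
    exact Finset.sum_congr rfl fun i _ => by ring
  rw [e3, ← hh]
  field_simp
  ring

/-- Eliminating a vertex does not decrease the spectral gap of the random walk. -/
theorem WalkPoincare.reduced {μ : ℝ} (hμ : 0 ≤ μ) (hw : ∀ x y, w x y = w y x)
    (h0 : ∀ x y, 0 ≤ w x y) (h : WalkPoincare w μ) : WalkPoincare (reducedWeight w) μ := by
  intro g hg
  set c : α → ℝ := fun i => w none (some i) with hc
  set z := (∑ k, c k * g k) / (∑ k, c k) with hz
  set m : ℝ := z / (Fintype.card α + 1) with hm
  -- The harmonic extension of `g`, recentred; its mean is `m` because `g` has zero sum.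
  let u : Option α → ℝ := fun x => x.elim z g - m
  have hcard : (0 : ℝ) < Fintype.card α + 1 := by positivity
  have hu : ∑ v, u v = 0 := by
    simp only [u, Fintype.sum_option, Option.elim, Finset.sum_sub_distrib, hg]
    simp
    rw [hm]; field_simp; ring
  have h1 := h u hu
  have h2 : walkForm w u = walkForm (reducedWeight w) g := by
    rw [walkForm_option hw]
    have := harmonic_extension_energy c g (fun i => h0 _ _)
    simp only [u, Option.elim, sub_sub_sub_cancel_right]
    rw [← hz] at this
    rw [← this, walkForm, ← mul_add, ← Finset.sum_add_distrib]
    congr 1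
    refine Finset.sum_congr rfl fun i _ => ?_
    rw [← Finset.sum_add_distrib]
    exact Finset.sum_congr rfl fun j _ => by rw [reducedWeight]; ring
  -- As `g` has zero sum, subtracting a constant only increases its norm.
  have h3 : ∑ v, g v ^ 2 ≤ ∑ v, u v ^ 2 := by
    have e : ∑ i, (g i - m) ^ 2 = ∑ i, g i ^ 2 - 2 * m * ∑ i, g i + Fintype.card α * m ^ 2 := by
      have : (Fintype.card α : ℝ) * m ^ 2 = ∑ i : α, m ^ 2 := by simp
      rw [this, Finset.mul_sum, ← Finset.sum_sub_distrib, ← Finset.sum_add_distrib]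
      exact Finset.sum_congr rfl fun i _ => by ring
    simp only [u, Fintype.sum_option, Option.elim]
    rw [e, hg]
    have : 0 ≤ (z - m) ^ 2 + Fintype.card α * m ^ 2 := by positivity
    linarith
  rw [← h2]
  exact (mul_le_mul_of_nonneg_left h3 hμ).trans h1

theorem interchangeForm_reduced_le [DecidableEq α] (hw : ∀ x y, w x y = w y x)
    (h0 : ∀ x y, 0 ≤ w x y) (f : Perm (Option α) → ℝ) :
    1 / 4 * ∑ i, ∑ j, reducedWeight w i j * swapEnergy f (some i) (some j)
      ≤ interchangeForm w f := by
  rw [interchangeForm_option hw]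
  have h := octopus_inequality (fun i => w none (some i)) (fun i => h0 _ _) f
  have hS : 0 ≤ ∑ k, w none (some k) := Finset.sum_nonneg fun k _ => h0 _ _
  have hD : ∀ x y, 0 ≤ swapEnergy f x y := fun x y => Finset.sum_nonneg fun _ _ => sq_nonneg _
  have e : ∑ i, ∑ j, reducedWeight w i j * swapEnergy f (some i) (some j)
      = ∑ i, ∑ j, w (some i) (some j) * swapEnergy f (some i) (some j)
        + (∑ i, ∑ j, w none (some i) * w none (some j) * swapEnergy f (some i) (some j))
          / ∑ k, w none (some k) := by
    simp only [Finset.sum_div, ← Finset.sum_add_distrib]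
    exact Finset.sum_congr rfl fun i _ => Finset.sum_congr rfl fun j _ => by
      rw [reducedWeight]; ring
  have h2 : (∑ i, ∑ j, w none (some i) * w none (some j) * swapEnergy f (some i) (some j))
          / ∑ k, w none (some k) ≤ 2 * ∑ i, w none (some i) * swapEnergy f none (some i) := by
    have hpos : 0 ≤ ∑ i, w none (some i) * swapEnergy f none (some i) :=
      Finset.sum_nonneg fun i _ => mul_nonneg (h0 _ _) (hD _ _)
    rcases hS.eq_or_lt with hS | hS
    · rw [← hS, div_zero]; linarith
    · rw [div_le_iff₀ hS]; linarith
  rw [e]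
  linarith

end Reduction

/-- Exchanges away from `none` preserve the particle sitting there, so they act inside each fibre.
-/
theorem decomposeOption_symm_mul_swap {α : Type*} [DecidableEq α] (i : Option α) (σ : Perm α)
    (y z : α) : Perm.decomposeOption.symm (i, σ) * swap (some y) (some z)
      = Perm.decomposeOption.symm (i, σ * swap y z) := by
  rw [← Equiv.optionCongr_swap]
  change swap none i * optionCongr σ * optionCongr (swap y z)
    = swap none i * optionCongr (σ * swap y z)
  rw [mul_assoc]
  congr 1
  refine Equiv.ext fun x => ?_
  cases x <;> rfl

/-- The interchange process has at least the spectral gap of the random walk: induction step. -/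
theorem InterchangePoincare.option {α : Type*} [Fintype α] [DecidableEq α]
    {w : Option α → Option α → ℝ} {μ : ℝ} (hw : ∀ x y, w x y = w y x)
    (h0 : ∀ x y, 0 ≤ w x y) (h : WalkPoincare w μ)
    (ih : InterchangePoincare (reducedWeight w) μ) : InterchangePoincare w μ := by
  intro f hf
  rw [← interchangeForm_eq, ← dotProduct_self_eq_sum_sq]
  refine poincare_of_eigenvalues_ge _ (exchangeOp_symmetric _ _ fun x y => mul_swap_involutive' x y)
    (exchangeOp_one _ _) μ ?_ f hf
  clear hf f
  intro ν f hf0 hf hAf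
  have hpos : 0 < ∑ η, f η ^ 2 := by
    rw [← dotProduct_self_eq_sum_sq]
    exact lt_of_le_of_ne (Finset.sum_nonneg fun s _ => mul_self_nonneg _)
      fun h => hf0 (dotProduct_self_eq_zero.1 h.symm)
  by_cases hfib : ∀ i, ∑ η : Perm (Option α), (if η none = i then 1 else 0) * f η = 0
  · have hform : f ⬝ᵥ exchangeOp w (fun x y η => η * swap x y) f = ν * ∑ η, f η ^ 2 := by
      rw [hAf, dotProduct_smul, dotProduct_self_eq_sum_sq, smul_eq_mul]
    rw [interchangeForm_eq] at hform
    have hsplit : ∀ F : Perm (Option α) → ℝ,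
        ∑ η, F η = ∑ i, ∑ σ, F (Perm.decomposeOption.symm (i, σ)) := fun F => by
      rw [← Equiv.sum_comp Perm.decomposeOption.symm, Fintype.sum_prod_type]
    -- The restriction of `f` to the configurations with particle `i` at `none`.
    let F : Option α → Perm α → ℝ := fun i σ => f (Perm.decomposeOption.symm (i, σ))
    have hF : ∀ i, ∑ σ, F i σ = 0 := fun i => by
      rw [← hfib i, hsplit]
      have hnone : ∀ (j : Option α) (σ : Perm α), Perm.decomposeOption.symm (j, σ) none = j :=
        fun j σ => swap_apply_left none j
      simp only [hnone]
      rw [Finset.sum_eq_single i]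
      · simp [F]
      · intro j _ hj; simp [hj]
      · simp
    have hE : ∀ y z, swapEnergy f (some y) (some z) = ∑ i, swapEnergy (F i) y z := fun y z => by
      rw [swapEnergy, hsplit]
      simp only [decomposeOption_symm_mul_swap]
      rfl
    have hsum := Finset.sum_le_sum fun i (_ : i ∈ Finset.univ) => ih (F i) (hF i)
    have hl : ∑ i, μ * ∑ σ, F i σ ^ 2 = μ * ∑ η, f η ^ 2 := by
      rw [← Finset.mul_sum, hsplit (fun η => f η ^ 2)]
    have hr : ∑ i, interchangeForm (reducedWeight w) (F i)
        = 1 / 4 * ∑ y, ∑ z, reducedWeight w y z * swapEnergy f (some y) (some z) := by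
      simp only [interchangeForm, ← Finset.mul_sum, hE]
      congr 1
      rw [Finset.sum_comm]
      refine Finset.sum_congr rfl fun y _ => ?_
      rw [Finset.sum_comm]
      simp only [Finset.mul_sum]
    rw [hl, hr] at hsum
    exact le_of_mul_le_mul_right
      ((hsum.trans (interchangeForm_reduced_le hw h0 f)).trans hform.le) hpos
  · push Not at hfib
    obtain ⟨i, hi⟩ := hfib
    -- Following only particle `i`, which performs the random walk; `g none ≠ 0` by the choice of
    -- `i`.
    let g : Option α → ℝ := fun v => ∑ η : Perm (Option α), (if η v = i then 1 else 0) * f η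
    have hAg : exchangeOp w (fun x y v => swap x y v) g = ν • g := by
      rw [exchangeOp_intertwine w _ (fun x y (η : Perm (Option α)) => η * swap x y)
        (fun x y => mul_swap_involutive' x y) (fun v η => if η v = i then 1 else 0)
        (fun x y s t => rfl) f, hAf]
      funext v
      simp only [g, Pi.smul_apply, smul_eq_mul, Finset.mul_sum]
      exact Finset.sum_congr rfl fun η _ => by ring
    have hg : ∑ v, g v = 0 := by
      simp only [g]
      rw [Finset.sum_comm]
      refine Eq.trans (Finset.sum_congr rfl fun η _ => ?_) hf
      rw [← Finset.sum_mul, Equiv.sum_comp η (fun v => if v = i then (1 : ℝ) else 0)]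
      simp
    have hg0 : 0 < ∑ v, g v ^ 2 :=
      Finset.sum_pos' (fun v _ => sq_nonneg _) ⟨none, Finset.mem_univ _, by positivity⟩
    have h1 := h g hg
    rw [← walkForm_eq, hAg, dotProduct_smul, dotProduct_self_eq_sum_sq, smul_eq_mul] at h1
    exact le_of_mul_le_mul_right h1 hg0

/-- The spectral gap of the interchange process is at least that of the random walk. -/
theorem interchangePoincare_of_walkPoincare (V : Type*) [Fintype V] :
    ∀ [DecidableEq V] (w : V → V → ℝ) (μ : ℝ), 0 ≤ μ → (∀ x y, w x y = w y x) →
      (∀ x y, 0 ≤ w x y) → WalkPoincare w μ → InterchangePoincare w μ := by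
  refine Fintype.induction_empty_option (P := fun V _ => ∀ [DecidableEq V] (w : V → V → ℝ) (μ : ℝ),
    0 ≤ μ → (∀ x y, w x y = w y x) → (∀ x y, 0 ≤ w x y) → WalkPoincare w μ →
      InterchangePoincare w μ) ?_ ?_ ?_ V
  · intro α β _ e ih _ w μ hμ hw h0 h
    classical
    let _ := Fintype.ofEquiv β e.symm
    have h' : WalkPoincare (fun x y => w (e x) (e y)) μ := by
      intro g hg
      have := h (g ∘ e.symm) (by rw [← hg]; exact Equiv.sum_comp e.symm g)
      have e1 : ∑ v, (g ∘ e.symm) v ^ 2 = ∑ v, g v ^ 2 :=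
        Equiv.sum_comp e.symm (fun v => g v ^ 2)
      have e2 : walkForm w (g ∘ e.symm) = walkForm (fun x y => w (e x) (e y)) g := by
        simp only [walkForm]
        rw [← Equiv.sum_comp e]
        congr 1
        refine Finset.sum_congr rfl fun x _ => ?_
        rw [← Equiv.sum_comp e]
        simp
      rwa [e1, e2] at this
    have := ih (fun x y => w (e x) (e y)) μ hμ (fun x y => hw _ _) (fun x y => h0 _ _) h'
    intro f hf
    have h2 := this (fun η => f (e.permCongr η)) (by
      rw [← hf]; exact Equiv.sum_comp e.permCongr f)
    have e1 : ∑ η, f (e.permCongr η) ^ 2 = ∑ η, f η ^ 2 :=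
      Equiv.sum_comp e.permCongr (fun η => f η ^ 2)
    have e2 : interchangeForm (fun x y => w (e x) (e y)) (fun η => f (e.permCongr η))
        = interchangeForm w f := by
      simp only [interchangeForm]
      symm
      rw [← Equiv.sum_comp e]
      congr 1
      refine Finset.sum_congr rfl fun x _ => ?_
      rw [← Equiv.sum_comp e]
      refine Finset.sum_congr rfl fun y _ => ?_
      congr 1
      simp only [swapEnergy]
      rw [← Equiv.sum_comp e.permCongr]
      refine Finset.sum_congr rfl fun η _ => ?_
      have : e.permCongr (η * swap x y) = e.permCongr η * swap (e x) (e y) := by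
        ext v
        simp [Equiv.permCongr_apply, ← Equiv.symm_apply_eq, swap_apply_def]
        split_ifs <;> simp_all
      rw [this]
    rwa [e1, e2] at h2
  · intro _ w μ _ _ _ _ f hf
    -- The empty type has a single permutation.
    have : f = 0 := by
      funext η
      rw [Fintype.sum_eq_single η (fun x hx => absurd (Subsingleton.elim x η) hx)] at hf
      exact hf
    subst this
    simp [interchangeForm, swapEnergy]
  · intro α _ ih inst w μ hμ hw h0 h
    classical
    have := InterchangePoincare.option hw h0 h (ih (reducedWeight w) μ hμ (reducedWeight_comm hw)
      (reducedWeight_nonneg h0) (h.reduced hμ hw h0))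
    convert this

end Interchange

/-! ### Colored exclusion as a quotient of the interchange process -/

section ColoredExclusion

variable {V : Type*} [Fintype V] [DecidableEq V]

/-- Each edge carries exactly two darts. -/
theorem two_mul_sum_edgeFinset (h : Sym2 V → ℝ) :
    2 * ∑ e ∈ (⊤ : SimpleGraph V).edgeFinset, h e
      = ∑ x, ∑ y, if x = y then 0 else h s(x, y) := by
  have h1 : ∑ d : (⊤ : SimpleGraph V).Dart, h d.edge
      = 2 * ∑ e ∈ (⊤ : SimpleGraph V).edgeFinset, h e := by
    rw [← Finset.sum_fiberwise_of_maps_to (t := (⊤ : SimpleGraph V).edgeFinset)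
      (g := fun d : (⊤ : SimpleGraph V).Dart => d.edge) (fun d _ => by
        rw [SimpleGraph.mem_edgeFinset]; exact d.edge_mem), Finset.mul_sum]
    refine Finset.sum_congr rfl fun e he => ?_
    rw [Finset.sum_congr rfl (g := fun _ => h e) (fun d hd => by
      rw [(Finset.mem_filter.1 hd).2]), Finset.sum_const,
      SimpleGraph.dart_edge_fiber_card (G := ⊤) e (SimpleGraph.mem_edgeFinset.1 he)]
    simp
  rw [← h1, ← Fintype.sum_prod_type']
  have h2 : ∑ p : V × V, (if p.1 = p.2 then 0 else h s(p.1, p.2))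
      = ∑ p ∈ (Finset.univ : Finset (V × V)) with p.1 ≠ p.2, h s(p.1, p.2) := by
    rw [Finset.sum_filter]
    exact Finset.sum_congr rfl fun p _ => by split_ifs <;> simp_all
  rw [h2]
  refine Finset.sum_bij (fun d _ => d.toProd) (fun d _ => ?_) (fun d _ d' _ hdd => ?_)
    (fun p hp => ?_) (fun d _ => rfl)
  · simp
  · exact SimpleGraph.Dart.ext _ _ hdd
  · exact ⟨⟨p, by simpa using hp⟩, Finset.mem_univ _, rfl⟩

/-- The conductances as a function of two vertices, extended by zero to the diagonal. -/
noncomputable def WeightedGraph.weight (G : WeightedGraph V) (x y : V) : ℝ :=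
  if x = y then 0 else G.c s(x, y)

omit [Fintype V] in
theorem WeightedGraph.weight_comm (G : WeightedGraph V) (x y : V) :
    G.weight x y = G.weight y x := by
  simp only [WeightedGraph.weight, eq_comm (a := x), Sym2.eq_swap (a := x)]

omit [Fintype V] in
theorem WeightedGraph.weight_nonneg (G : WeightedGraph V) (x y : V) : 0 ≤ G.weight x y := by
  unfold WeightedGraph.weight
  split_ifs with h
  · exact le_rfl
  · exact G.c_nonneg x y h

theorem neg_randomWalkGenerator (G : WeightedGraph V) :
    -G.randomWalkGenerator = exchangeOp G.weight fun x y v => swap x y v := by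
  refine LinearMap.ext fun f => funext fun v => ?_
  have hrow : ∀ x, x ≠ v → ∑ y, G.weight x y * (f v - f (swap x y v))
      = G.weight x v * (f v - f x) := by
    intro x hx
    rw [Finset.sum_eq_single v]
    · rw [swap_apply_right]
    · intro y _ hy
      rw [swap_apply_of_ne_of_ne hx.symm hy.symm]; ring
    · simp
  rw [exchangeOp_apply, ← Finset.add_sum_erase _ _ (Finset.mem_univ v),
    Finset.sum_congr rfl (fun x hx => hrow x (Finset.ne_of_mem_erase hx)),
    ← Finset.add_sum_erase _ _ (Finset.mem_univ v)]
  have e : ∀ x ∈ Finset.univ.erase v, G.weight x v * (f v - f x)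
      = -(G.c s(v, x) * (f x - f v)) := fun x hx => by
    rw [G.weight_comm, WeightedGraph.weight, if_neg (Finset.ne_of_mem_erase hx).symm]; ring
  have e' : ∀ x ∈ Finset.univ.erase v, G.weight v x * (f v - f (swap v x v))
      = -(G.c s(v, x) * (f x - f v)) := fun x hx => by
    rw [swap_apply_left, G.weight_comm, e x hx]
  rw [Finset.sum_congr rfl e, Finset.sum_congr rfl e', Finset.sum_neg_distrib]
  simp only [swap_self, refl_apply, sub_self, mul_zero, zero_add, LinearMap.neg_apply, Pi.neg_apply,
    WeightedGraph.randomWalkGenerator, LinearMap.coe_mk, AddHom.coe_mk]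
  ring

variable {r : ℕ} {n : Fin r → ℕ}

theorem ColoredConfig.exchange_involutive (e : Sym2 V) :
    Function.Involutive (fun α : ColoredConfig V n => α.exchange e) := by
  intro α
  induction e with
  | _ x y =>
    refine Subtype.ext (funext fun i => Finset.ext fun v => ?_)
    simp [ColoredConfig.exchange, pairSwap]

theorem ColoredConfig.mem_exchange (x y v : V) (α : ColoredConfig V n) (i : Fin r) :
    v ∈ (α.exchange s(x, y)).1 i ↔ swap x y v ∈ α.1 i := by
  simp only [ColoredConfig.exchange, pairSwap, Sym2.lift_mk, Finset.mem_map_equiv, symm_swap]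

theorem neg_coloredExclusionGenerator (G : WeightedGraph V) :
    -G.coloredExclusionGenerator n
      = exchangeOp G.weight fun x y (α : ColoredConfig V n) => α.exchange s(x, y) := by
  refine LinearMap.ext fun f => funext fun α => ?_
  have h := two_mul_sum_edgeFinset (V := V) (fun e => G.c e * (f (α.exchange e) - f α))
  have h2 : ∑ x, ∑ y, G.weight x y * (f α - f (α.exchange s(x, y)))
      = -∑ x, ∑ y, if x = y then 0 else G.c s(x, y) * (f (α.exchange s(x, y)) - f α) := by
    simp only [← Finset.sum_neg_distrib, WeightedGraph.weight]
    refine Finset.sum_congr rfl fun x _ => Finset.sum_congr rfl fun y _ => ?_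
    split_ifs <;> ring
  rw [exchangeOp_apply, h2, ← h]
  simp only [LinearMap.neg_apply, Pi.neg_apply,
    WeightedGraph.coloredExclusionGenerator, LinearMap.coe_mk, AddHom.coe_mk]
  ring

/-- The configuration obtained by moving all particles by a permutation of the vertices. -/
def ColoredConfig.move (σ : Perm V) (α : ColoredConfig V n) : ColoredConfig V n :=
  ⟨fun i => (α.1 i).map σ.toEmbedding,
    fun i j hij => (Finset.disjoint_map _).2 (α.2.1 i j hij),
    fun x => by
      obtain ⟨i, hi⟩ := α.2.2.1 (σ.symm x)
      exact ⟨i, Finset.mem_map.2 ⟨_, hi, σ.apply_symm_apply x⟩⟩,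
    fun i => (Finset.card_map _).trans (α.2.2.2 i)⟩

theorem ColoredConfig.move_mul (σ τ : Perm V) (α : ColoredConfig V n) :
    α.move (σ * τ) = (α.move τ).move σ := by
  refine Subtype.ext (funext fun i => Finset.ext fun v => ?_)
  simp only [ColoredConfig.move, Finset.mem_map_equiv]
  rfl

theorem ColoredConfig.move_one (α : ColoredConfig V n) : α.move 1 = α := by
  refine Subtype.ext (funext fun i => Finset.ext fun v => ?_)
  simp only [ColoredConfig.move, Finset.mem_map_equiv]
  rfl

theorem ColoredConfig.move_swap (x y : V) (α : ColoredConfig V n) :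
    α.move (swap x y) = α.exchange s(x, y) := rfl

/-- Classes of the same color have equal size; bijections between them glue to a permutation. -/
theorem ColoredConfig.exists_move_eq (α β : ColoredConfig V n) : ∃ σ, α.move σ = β := by
  choose a ha using α.2.2.1
  choose b hb using β.2.2.1
  have huniq : ∀ (γ : ColoredConfig V n) (v : V) (i j : Fin r), v ∈ γ.1 i → v ∈ γ.1 j → i = j := by
    intro γ v i j hi hj
    by_contra hij
    exact Finset.disjoint_left.1 (γ.2.1 i j hij) hi hj
  have hfib : ∀ i, Nonempty ({v // a v = i} ≃ {v // b v = i}) := fun i => by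
    have e1 : Fintype.card {v // a v = i} = n i := by
      rw [← α.2.2.2 i, Fintype.card_subtype]
      congr 1
      ext v
      simp only [Finset.mem_filter, Finset.mem_univ, true_and]
      exact ⟨fun h => h ▸ ha v, fun h => huniq α v _ _ (ha v) h⟩
    have e2 : Fintype.card {v // b v = i} = n i := by
      rw [← β.2.2.2 i, Fintype.card_subtype]
      congr 1
      ext v
      simp only [Finset.mem_filter, Finset.mem_univ, true_and]
      exact ⟨fun h => h ▸ hb v, fun h => huniq β v _ _ (hb v) h⟩
    exact ⟨Fintype.equivOfCardEq (e1.trans e2.symm)⟩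
  let φ := fun i => (hfib i).some
  let σ : Perm V := (Equiv.sigmaFiberEquiv a).symm.trans
    ((Equiv.sigmaCongrRight φ).trans (Equiv.sigmaFiberEquiv b))
  have hσ : ∀ v, b (σ v) = a v := fun v => (φ (a v) ⟨v, rfl⟩).2
  refine ⟨σ, Subtype.ext (funext fun i => Finset.ext fun v => ?_)⟩
  obtain ⟨u, rfl⟩ := σ.surjective v
  simp only [ColoredConfig.move, Finset.mem_map_equiv, symm_apply_apply]
  constructor
  · intro h
    rw [huniq α u i (a u) h (ha u), ← hσ]
    exact hb _
  · intro h
    rw [huniq β _ i _ h (hb _), hσ]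
    exact ha u

theorem ColoredConfig.exists_of_sum_eq (hsum : ∑ i, n i = Fintype.card V) :
    Nonempty (ColoredConfig V n) := by
  have e : V ≃ Σ i, Fin (n i) := Fintype.equivOfCardEq (by simp [hsum])
  refine ⟨⟨fun i => Finset.univ.filter fun v => (e v).1 = i, fun i j hij => ?_, fun v => ?_,
    fun i => ?_⟩⟩
  · rw [Finset.disjoint_filter]
    rintro v - rfl h
    exact hij h
  · exact ⟨(e v).1, by simp⟩
  · have : (Finset.univ.filter fun v => (e v).1 = i)
        = (Finset.univ : Finset (Fin (n i))).map
          ((Function.Embedding.sigmaMk i).trans e.symm.toEmbedding) := by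
      ext v
      simp only [Finset.mem_filter, Finset.mem_univ, true_and, Finset.mem_map,
        Function.Embedding.trans_apply, Function.Embedding.sigmaMk_apply, coe_toEmbedding]
      constructor
      · rintro rfl
        exact ⟨(e v).2, e.symm_apply_apply v⟩
      · rintro ⟨k, rfl⟩
        simp
    simp only [this, Finset.card_map, Finset.card_univ, Fintype.card_fin]

/-- The inverse turns right multiplication by a transposition into an exchange applied last to the
configuration. -/
theorem exchangeOp_pullback (w : V → V → ℝ) (f : ColoredConfig V n → ℝ) (α : ColoredConfig V n) :
    exchangeOp w (fun x y η => η * swap x y) (fun η : Perm V => f (α.move η⁻¹))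
      = fun η => exchangeOp w (fun x y (β : ColoredConfig V n) => β.exchange s(x, y)) f
        (α.move η⁻¹) := by
  funext η
  simp only [exchangeOp_apply, mul_inv_rev, swap_inv, ColoredConfig.move_mul,
    ColoredConfig.move_swap]

/-- By transitivity the sum does not depend on the base configuration, and its total over all base
configurations is zero. -/
theorem sum_pullback_eq_zero {f : ColoredConfig V n → ℝ} (hf : ∑ β, f β = 0)
    (α : ColoredConfig V n) : ∑ η : Perm V, f (α.move η⁻¹) = 0 := by
  have hconst : ∀ β : ColoredConfig V n, ∑ η : Perm V, f (β.move η⁻¹) = ∑ η : Perm V, f (α.move η⁻¹) := by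
    intro β
    obtain ⟨σ, rfl⟩ := α.exists_move_eq β
    rw [← Equiv.sum_comp (Equiv.mulLeft σ)]
    simp [← ColoredConfig.move_mul]
  have hinv : ∀ η : Perm V, ∑ β : ColoredConfig V n, f (β.move η⁻¹) = 0 := by
    intro η
    let m : Perm (ColoredConfig V n) :=
      { toFun := fun β => β.move η⁻¹
        invFun := fun β => β.move η
        left_inv := fun β => by simp [← ColoredConfig.move_mul, ColoredConfig.move_one]
        right_inv := fun β => by simp [← ColoredConfig.move_mul, ColoredConfig.move_one] }
    rw [← hf]
    exact Equiv.sum_comp m f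
  have h : ∑ β : ColoredConfig V n, ∑ η : Perm V, f (β.move η⁻¹) = 0 := by
    rw [Finset.sum_comm]
    exact Finset.sum_eq_zero fun η _ => hinv η
  simp only [hconst, Finset.sum_const, nsmul_eq_mul, mul_eq_zero, Nat.cast_eq_zero,
    Finset.card_eq_zero, Finset.univ_eq_empty_iff] at h
  exact h.resolve_left fun h => h.false α

/-- The Poincaré inequality of the random walk passes to the colored exclusion process. -/
theorem coloredExclusion_poincare (G : WeightedGraph V) {μ : ℝ} (hμ : 0 ≤ μ)
    (h : WalkPoincare G.weight μ) (f : ColoredConfig V n → ℝ) (hf : ∑ α, f α = 0) :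
    μ * (f ⬝ᵥ f) ≤ f ⬝ᵥ
      exchangeOp G.weight (fun x y (α : ColoredConfig V n) => α.exchange s(x, y)) f := by
  refine poincare_of_eigenvalues_ge _
    (exchangeOp_symmetric _ _ fun x y => ColoredConfig.exchange_involutive s(x, y))
    (exchangeOp_one _ _) μ ?_ f hf
  clear hf f
  intro ν f hf0 hf hAf
  -- A base point where `f` is nonzero makes the pullback nonzero at the identity.
  obtain ⟨α, hα⟩ : ∃ α, f α ≠ 0 := Function.ne_iff.1 hf0
  let F : Perm V → ℝ := fun η => f (α.move η⁻¹)
  have hAF : exchangeOp G.weight (fun x y η => η * swap x y) F = ν • F := by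
    rw [exchangeOp_pullback, hAf]
    rfl
  have hF0 : 0 < ∑ η, F η ^ 2 := by
    refine Finset.sum_pos' (fun v _ => sq_nonneg _) ⟨1, Finset.mem_univ _, ?_⟩
    have : F 1 ≠ 0 := by simpa [F, ColoredConfig.move_one] using hα
    positivity
  have h1 := interchangePoincare_of_walkPoincare V G.weight μ hμ G.weight_comm G.weight_nonneg h
    F (sum_pullback_eq_zero hf α)
  rw [← interchangeForm_eq, hAF, dotProduct_smul, dotProduct_self_eq_sum_sq, smul_eq_mul] at h1
  exact le_of_mul_le_mul_right h1 hF0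

omit [Fintype V] [DecidableEq V] in
theorem eq_of_adj_eq_of_connected {H : SimpleGraph V} (hH : H.Connected) {g : V → ℝ}
    (h : ∀ x y, H.Adj x y → g x = g y) (x y : V) : g x = g y := by
  obtain ⟨p⟩ := hH.preconnected x y
  induction p with
  | nil => rfl
  | cons hadj _ ih => exact (h _ _ hadj).trans ih

theorem walkForm_weight_pos (G : WeightedGraph V) (hG : G.skeleton.Connected) {g : V → ℝ}
    (hg : ∃ x y, g x ≠ g y) : 0 < walkForm G.weight g := by
  have hnn : ∀ x y, 0 ≤ G.weight x y * (g x - g y) ^ 2 := fun x y =>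
    mul_nonneg (G.weight_nonneg x y) (sq_nonneg _)
  by_contra hle
  obtain ⟨x, y, hxy⟩ := hg
  refine hxy (eq_of_adj_eq_of_connected hG (fun x y hadj => ?_) x y)
  have h0 : ∑ x, ∑ y, G.weight x y * (g x - g y) ^ 2 = 0 := by
    refine le_antisymm ?_ (Finset.sum_nonneg fun x _ => Finset.sum_nonneg fun y _ => hnn x y)
    unfold walkForm at hle
    linarith
  rw [Finset.sum_eq_zero_iff_of_nonneg fun x _ => Finset.sum_nonneg fun y _ => hnn x y] at h0
  have h1 := h0 x (Finset.mem_univ _)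
  rw [Finset.sum_eq_zero_iff_of_nonneg fun y _ => hnn x y] at h1
  have h2 := h1 y (Finset.mem_univ _)
  have hpos : 0 < G.weight x y := by
    rw [WeightedGraph.weight, if_neg hadj.1]; exact hadj.2
  rcases mul_eq_zero.1 h2 with h3 | h3
  · exact absurd h3 hpos.ne'
  · exact sub_eq_zero.1 (pow_eq_zero_iff two_ne_zero |>.1 h3)

/-- Summing a function over the vertices of color `i` intertwines the random walk with the colored
exclusion process. -/
theorem exchangeOp_lift (w : V → V → ℝ) (i : Fin r) (g : V → ℝ) :
    exchangeOp w (fun x y (α : ColoredConfig V n) => α.exchange s(x, y))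
        (fun α => ∑ v, (if v ∈ α.1 i then 1 else 0) * g v)
      = fun α => ∑ v, (if v ∈ α.1 i then 1 else 0) * exchangeOp w (fun x y v => swap x y v) g v :=
  exchangeOp_intertwine w _ _ (fun x y => swap_involutive x y)
    (fun (α : ColoredConfig V n) v => if v ∈ α.1 i then 1 else 0)
    (fun x y α v => by simp only [ColoredConfig.mem_exchange]) g

/-- Exchanging a vertex `x` of color `i` with a vertex `y` of another color changes the sum by `g y
- g x`. If all sums vanish, `g` takes equal values inside and outside the class, so it is constant.
-/
theorem lift_ne_zero {i j : Fin r} (hij : i ≠ j) (hi : 1 ≤ n i) (hj : 1 ≤ n j)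
    (α₀ : ColoredConfig V n) {g : V → ℝ} (hg : ∃ x y, g x ≠ g y) :
    (fun α : ColoredConfig V n => ∑ v, (if v ∈ α.1 i then 1 else 0) * g v) ≠ 0 := by
  intro h0
  have hsum : ∀ α : ColoredConfig V n, ∑ v, (if v ∈ α.1 i then 1 else 0) * g v = 0 :=
    fun α => congrFun h0 α
  have hkey : ∀ x ∈ α₀.1 i, ∀ y ∉ α₀.1 i, g x = g y := by
    intro x hx y hy
    have hxy : x ≠ y := fun h => hy (h ▸ hx)
    have h1 := hsum α₀
    have h2 := hsum (α₀.exchange s(x, y))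
    have h3 : ∑ v, ((if v ∈ α₀.1 i then 1 else 0) * g v
        - (if v ∈ (α₀.exchange s(x, y)).1 i then 1 else 0) * g v) = g x - g y := by
      rw [← Finset.sum_subset (Finset.subset_univ {x, y})]
      · rw [Finset.sum_pair hxy]
        simp only [ColoredConfig.mem_exchange, swap_apply_left, swap_apply_right, if_pos hx,
          if_neg hy]
        ring
      · intro v _ hv
        simp only [Finset.mem_insert, Finset.mem_singleton, not_or] at hv
        simp only [ColoredConfig.mem_exchange, swap_apply_of_ne_of_ne hv.1 hv.2, sub_self]
    rw [Finset.sum_sub_distrib, h1, h2] at h3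
    linarith
  obtain ⟨x₀, hx₀⟩ : (α₀.1 i).Nonempty := Finset.card_pos.1 (by rw [α₀.2.2.2]; omega)
  obtain ⟨y₀, hy₀⟩ : (α₀.1 j).Nonempty := Finset.card_pos.1 (by rw [α₀.2.2.2]; omega)
  have hy₀' : y₀ ∉ α₀.1 i := fun h => Finset.disjoint_left.1 (α₀.2.1 i j hij) h hy₀
  have hconst : ∀ v, g v = g x₀ := fun v => by
    by_cases hv : v ∈ α₀.1 i
    · rw [hkey v hv y₀ hy₀', hkey x₀ hx₀ y₀ hy₀']
    · exact (hkey x₀ hx₀ v hv).symm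
  obtain ⟨x, y, hxy⟩ := hg
  exact hxy ((hconst x).trans (hconst y).symm)

end ColoredExclusion

theorem mainTheorem6 {V : Type*} [Fintype V] [DecidableEq V]
    (G : WeightedGraph V) (hG : G.skeleton.Connected)
    (r : ℕ) (hr : 2 ≤ r) (n : Fin r → ℕ) (hn : ∀ i, 1 ≤ n i)
    (hsum : ∑ i, n i = Fintype.card V) :
    spectralGap (G.coloredExclusionGenerator n) = spectralGap G.randomWalkGenerator := by
  obtain ⟨α₀⟩ := ColoredConfig.exists_of_sum_eq (V := V) hsum
  let i : Fin r := ⟨0, by omega⟩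
  let j : Fin r := ⟨1, by omega⟩
  have hij : i ≠ j := by simp [i, j]
  obtain ⟨x₀, hx₀⟩ : (α₀.1 i).Nonempty := Finset.card_pos.1 (by rw [α₀.2.2.2]; exact hn i)
  obtain ⟨y₀, hy₀⟩ : (α₀.1 j).Nonempty := Finset.card_pos.1 (by rw [α₀.2.2.2]; exact hn j)
  have : Nontrivial V :=
    ⟨x₀, y₀, fun h => Finset.disjoint_left.1 (α₀.2.1 i j hij) hx₀ (h ▸ hy₀)⟩
  have hsymm := exchangeOp_symmetric G.weight _ fun x y : V => swap_involutive x y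
  obtain ⟨μ, g, hg0, hg, hAg, hP⟩ := exists_minimal_eigenpair _ hsymm (exchangeOp_one _ _)
  have hW : WalkPoincare G.weight μ := fun u hu => by
    rw [← walkForm_eq, ← dotProduct_self_eq_sum_sq]
    exact hP u hu
  have hgpos : 0 < g ⬝ᵥ g :=
    lt_of_le_of_ne (Finset.sum_nonneg fun s _ => mul_self_nonneg _)
      fun h => hg0 (dotProduct_self_eq_zero.1 h.symm)
  have hgc : ∃ x y, g x ≠ g y := by
    by_contra! hc
    refine hg0 (funext fun x => ?_)
    rw [Finset.sum_congr rfl (fun v _ => hc v x)] at hg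
    simpa using hg
  -- Connectedness enters here: a nonconstant function has positive energy.
  have hμ : 0 < μ := by
    have h := walkForm_weight_pos G hG hgc
    rw [← walkForm_eq, hAg, dotProduct_smul, smul_eq_mul] at h
    exact pos_of_mul_pos_left h hgpos.le
  have hRW : spectralGap G.randomWalkGenerator = μ := by
    refine spectralGap_eq_of_eigenpair _ ?_ ?_ μ hμ.le g hg0 hg ?_ ?_ <;>
      rw [neg_randomWalkGenerator]
    · exact hsymm
    · exact exchangeOp_one _ _
    · exact hAg
    · exact hP
  have hsymm' := exchangeOp_symmetric G.weight _
    fun x y : V => ColoredConfig.exchange_involutive (n := n) s(x, y)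
  let f : ColoredConfig V n → ℝ := fun α => ∑ v, (if v ∈ α.1 i then 1 else 0) * g v
  have hAf : exchangeOp G.weight (fun x y (α : ColoredConfig V n) => α.exchange s(x, y)) f
      = μ • f := by
    rw [exchangeOp_lift, hAg]
    funext α
    simp only [f, Pi.smul_apply, smul_eq_mul, Finset.mul_sum]
    exact Finset.sum_congr rfl fun v _ => by ring
  -- Eigenfunctions with nonzero eigenvalue are orthogonal to the constants.
  have hf : ∑ α, f α = 0 := by
    have h := hsymm' 1 f
    rw [exchangeOp_one, zero_dotProduct, hAf, dotProduct_smul, one_dotProduct, smul_eq_mul] at h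
    exact (mul_eq_zero.1 h).resolve_left hμ.ne'
  rw [hRW]
  refine spectralGap_eq_of_eigenpair _ ?_ ?_ μ hμ.le f (lift_ne_zero hij (hn i) (hn j) α₀ hgc) hf
    ?_ ?_ <;> rw [neg_coloredExclusionGenerator]
  · exact hsymm'
  · exact exchangeOp_one _ _
  · exact hAf
  · exact coloredExclusion_poincare G hμ.le hW
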